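/- Let $I=(-1,1)$, $\beta>0$, $y_d\in L_2(I)$, $f\in H^{\frac12-\epsilon}(I)$ and $\psi\in H^{\frac32-\epsilon}(I)$ for all $\epsilon\in(0,\frac12]$, and $\int_I\psi\,dx>0$ (functions in $H^s(I)$ with $s>\frac12$ are identified with their continuous representatives on $[-1,1]$). Consider the optimal control problem with Dirichlet boundary conditions: minimize $$J(y,u)=\tfrac12\big[\|y-y_d\|_{L_2(I)}^2+\beta\|u\|_{L_2(I)}^2\big]$$ over all $(y,u)\in H^2(I)\times L_2(I)$ with $-y''=u+f$ and $y'\le\psi$ on $I$ and $y(-1)=y(1)=0$. For a partition $\mathcal T_h$ of $I$ with nodes $-1=x_0<x_1<\dots<x_n=1$ and mesh size $h=\max_i(x_{i+1}-x_i)$, let $V_h$ be the cubic Hermite space of functions $v\in C^1([-1,1])$ that are polynomials of degree at most $3$ on each $[x_i,x_{i+1}]$ and satisfy $v(-1)=v(1)=0$. Let $P_h$ be the nodal interpolation operator into the continuous piecewise affine functions on $\mathcal T_h$. The discrete problem is to minimize $\frac12\big[\|y_h-y_d\|_{L_2(I)}^2+\beta\|y_h''+f\|_{L_2(I)}^2\big]$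 over all $y_h\in V_h$ with $P_hy_h'\le P_h\psi$ on $[-1,1]$ (that is, $y_h'(x_i)\le\psi(x_i)$ at all nodes). Then the optimal control problem has a unique solution $(\bar y,\bar u)$, and for every partition the discrete problem has a unique solution $\bar y_h$. Put $\bar u_h=-\bar y_h''-f$. For every $\gamma$ and every $\epsilon>0$ there is a constant $C_\epsilon>0$, depending only on $\epsilon$, $\gamma$ and the data $\beta,y_d,f,\psi$, such that for every partition that is quasi-uniform with constant $\gamma$ (that is, $h\le\gamma\,(x_{i+1}-x_i)$ for all $i$), $$|\bar y-\bar y_h|_{H^1(I)}+\|\bar u-\bar u_h\|_{L_2(I)}\le C_\epsilon h^{\frac12-\epsilon} \quad\text{and}\quad \|\bar y-\bar y_h\|_a\le C_\epsilon h^{\frac12-\epsilon},$$ where $\|v\|_a^2=\|v\|_{L_2(I)}^2+\beta|v|_{H^2(I)}^2$ is the energy norm. -/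

import Mathlib

open MeasureTheory Set Polynomial
open scoped ContDiff

namespace DirichletOCP

noncomputable section

/-- The open interval `I = (-1, 1)`. -/
def I : Set ℝ := Ioo (-1) 1

/-- Lebesgue measure on `I`. -/
def volI : Measure ℝ := volume.restrict I

/-- Square integrability on `I`. Functions on `I` are represented by functions `ℝ → ℝ`, whose values
outside of `[-1, 1]` are irrelevant. -/
def MemL2 (g : ℝ → ℝ) : Prop := MemLp g 2 volI

/-- The norm of `L₂(I)`. -/
def normL2 (g : ℝ → ℝ) : ℝ := Real.sqrt (∫ x, g x ^ 2 ∂volI)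

/-- `g'` is the weak (distributional) derivative of `g` on `I`. -/
def IsWeakDeriv (g g' : ℝ → ℝ) : Prop :=
  LocallyIntegrableOn g I ∧ LocallyIntegrableOn g' I ∧
    ∀ φ : ℝ → ℝ, ContDiff ℝ ∞ φ → HasCompactSupport φ → tsupport φ ⊆ I →
      ∫ x, g x * deriv φ x ∂volI = -∫ x, g' x * φ x ∂volI

open Classical in
/-- The weak derivative of `g` on `I` (unique up to null sets); `0` if there is none. -/
def weakDeriv (g : ℝ → ℝ) : ℝ → ℝ :=
  if h : ∃ g', IsWeakDeriv g g' then h.choose else 0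

/-- The Gagliardo-Slobodeckij seminorm of order `σ ∈ (0, 1)` of `g` on `I` is finite. -/
def GagliardoFinite (σ : ℝ) (g : ℝ → ℝ) : Prop :=
  ∫⁻ x, ∫⁻ y, ENNReal.ofReal ((g x - g y) ^ 2 / |x - y| ^ (1 + 2 * σ)) ∂volI ∂volI < ⊤

/-- The space `H^{m+σ}(I)`, for `m ∈ ℕ` and `σ ∈ [0, 1)`: the weak derivatives up to order `m` are in
`L₂(I)`, and the last one has a finite seminorm of order `σ` if `σ ≠ 0`. -/
def MemSobolevAux (σ : ℝ) : ℕ → (ℝ → ℝ) → Prop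
  | 0, g => MemL2 g ∧ (σ ≠ 0 → GagliardoFinite σ g)
  | m + 1, g => MemL2 g ∧ ∃ g', IsWeakDeriv g g' ∧ MemSobolevAux σ m g'

/-- The Sobolev(-Slobodeckij) space `H^s(I)`, for real `s ≥ 0`. -/
def MemSobolev (s : ℝ) (g : ℝ → ℝ) : Prop := MemSobolevAux (Int.fract s) ⌊s⌋₊ g

/-- The seminorm `|g|_{H^k(I)}`, the `L₂(I)` norm of the weak derivative of order `k`. -/
def seminormH (k : ℕ) (g : ℝ → ℝ) : ℝ := normL2 (weakDeriv^[k] g)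

/-- The energy norm `(‖v‖² + β |v|²)^{1/2}`, with the norm of `L₂(I)` and the seminorm of `H²(I)`. -/
def energyNorm (β : ℝ) (v : ℝ → ℝ) : ℝ :=
  Real.sqrt (normL2 v ^ 2 + β * seminormH 2 v ^ 2)

/-- The cost functional `J(y, u)`. -/
def cost (β : ℝ) (yd y u : ℝ → ℝ) : ℝ :=
  1 / 2 * (normL2 (y - yd) ^ 2 + β * normL2 u ^ 2)

/-- The space `V = {v ∈ H²(I) : v(-1) = v(1) = 0}`; a member of `H²(I)` is represented by the function
that is continuous on `[-1, 1]`. -/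
def MemV (v : ℝ → ℝ) : Prop :=
  MemSobolev 2 v ∧ ContinuousOn v (Icc (-1) 1) ∧ v (-1) = 0 ∧ v 1 = 0

/-- The admissible pairs: `y ∈ V`, `u ∈ L₂(I)`, `-y'' = u + f` and `y' ≤ ψ` on `I`. -/
def Admissible (f ψ y u : ℝ → ℝ) : Prop :=
  MemV y ∧ MemL2 u ∧ (∀ᵐ x ∂volI, -(weakDeriv^[2] y) x = u x + f x) ∧
    ∀ᵐ x ∂volI, weakDeriv y x ≤ ψ x

/-- `(y, u)` solves the optimal control problem with Dirichlet boundary conditions. -/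
def IsSolution (β : ℝ) (yd f ψ y u : ℝ → ℝ) : Prop :=
  Admissible f ψ y u ∧ ∀ z w, Admissible f ψ z w → cost β yd y u ≤ cost β yd z w

/-- A partition `-1 = x_0 < x_1 < ⋯ < x_n = 1` of `I`. -/
structure Mesh where
  n : ℕ
  node : Fin (n + 1) → ℝ
  strictMono : StrictMono node
  node_zero : node 0 = -1
  node_last : node (Fin.last n) = 1

namespace Mesh

variable (M : Mesh)

/-- The length of the `i`-th cell `[x_i, x_{i+1}]`. -/
def len (i : Fin M.n) : ℝ := M.node i.succ - M.node i.castSucc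

/-- The `i`-th closed cell. -/
def cell (i : Fin M.n) : Set ℝ := Icc (M.node i.castSucc) (M.node i.succ)

/-- The mesh size, the maximal length of a cell. -/
def h : ℝ := ⨆ i, M.len i

/-- Quasi-uniformity with constant `γ`. -/
def QuasiUniform (γ : ℝ) : Prop := ∀ i, M.h ≤ γ * M.len i

open Classical in
/-- The nodal interpolation operator `P_h` of the `P₁` finite element space: `P_h g` is affine on each
cell and agrees with `g` at the nodes. (At a node, the two adjacent cells give the same value.) -/
def nodalP1 (g : ℝ → ℝ) (x : ℝ) : ℝ :=
  if hx : ∃ i, x ∈ M.cell i then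
    g (M.node hx.choose.castSucc) + (x - M.node hx.choose.castSucc) / M.len hx.choose *
      (g (M.node hx.choose.succ) - g (M.node hx.choose.castSucc))
  else 0

/-- The cubic Hermite finite element space `V_h ⊂ V`: continuously differentiable functions on
`[-1, 1]` that are cubic polynomials on each cell and vanish at `-1` and `1`. -/
def MemVh (v : ℝ → ℝ) : Prop :=
  ContDiffOn ℝ 1 v (Icc (-1) 1) ∧ v (-1) = 0 ∧ v 1 = 0 ∧
    ∀ i, ∃ p : ℝ[X], p.natDegree ≤ 3 ∧ ∀ x ∈ M.cell i, v x = p.eval x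

/-- The discrete admissible set `K_h`: members of `V_h` with `P_h y' ≤ P_h ψ` on `[-1, 1]`. -/
def MemKh (ψ v : ℝ → ℝ) : Prop :=
  M.MemVh v ∧
    ∀ x ∈ Icc (-1 : ℝ) 1, M.nodalP1 (derivWithin v (Icc (-1) 1)) x ≤ M.nodalP1 ψ x

/-- `y` solves the discrete problem: it minimizes `(‖y - y_d‖² + β ‖y'' + f‖²) / 2` over `K_h`. -/
def IsDiscreteSolution (β : ℝ) (yd f ψ y : ℝ → ℝ) : Prop :=
  M.MemKh ψ y ∧ ∀ z, M.MemKh ψ z →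
    cost β yd y (weakDeriv^[2] y + f) ≤ cost β yd z (weakDeriv^[2] z + f)

end Mesh

end

end DirichletOCP

namespace DirichletOCP

/-! ### Primitives of square integrable functions -/

/-! The unknown is `k = y''`. A function in `V` is determined by `k ∈ L₂(I)`: its derivative is the
mean-zero primitive `mzPrim k` and the function itself is `dirSol k` (`memV_iff`). Members of `V_h`
correspond to piecewise affine `k` (`IsPwAffine.memVh`, `MemVh.exists_isPwAffine`). Both problems
thus minimize the same strictly convex quadratic functional `redCost` over closed convex sets in
`L₂(I)`, which gives existence and uniqueness (`IsClosedConvexL2.exists_isRedMin`,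
`IsRedMin.ae_eq`).

Let `g = ȳ''`. Admissible directions have mean-zero derivatives `q`, so the derivative of the
functional, viewed as a functional of `q`, may be changed by a multiple of `∫ q`. Since `∫ ψ > 0`,
the slack `ψ - ȳ'` has positive integral, and one multiple makes the functional vanish at the slack.
The variational inequality then makes it nonnegative on all nonnegative `q`, of any mean
(`IsRedMin.exists_multiplier`). This is the multiplier, written as `q ↦ ∫ Θ q - ∫ m q'` with `m = β
(g + f)`; no measure is needed.

Testing the multiplier with ramps and trapezoids shows that `m + prim Θ` is bounded and monotone
(`DualNonneg.exists_monotone`). Hence `g` is a monotone function minus a Lipschitz one, scaled,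
minus `f`. Each piece is approximated by piecewise constants in `L₂` with every order `0 < α < 1/2`:
the first two by monotonicity, `f` by its Gagliardo seminorm. The same holds for `ψ'`.

For the error, let `z` be the `L₂` projection of `g` onto piecewise affine functions. It preserves
the nodal values of `mzPrim`, so it is feasible for the discrete problem
(`Mesh.exists_isPwAffine_projection`). The discrete variational inequality bounds the energy of `z -
ȳ_h''` by a projection error and the multiplier at `ȳ_h' - mzPrim z`. At the nodes this function
lies below the slack; between nodes it exceeds it by at most `√h` times small `L₂` quantities
(`const_add_prim_le`). As the multiplier is monotone and vanishes at the slack, a quadratic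
inequality for the error results (`IsRedMin.exists_error_le`). -/

theorem integral_volI (F : ℝ → ℝ) : ∫ x, F x ∂volI = ∫ x in (-1 : ℝ)..1, F x := by
  rw [intervalIntegral.integral_of_le (by norm_num), integral_Ioc_eq_integral_Ioo]; rfl

theorem ae_volI_iff {p : ℝ → Prop} : (∀ᵐ x ∂volI, p x) ↔ ∀ᵐ x, x ∈ I → p x :=
  ae_restrict_iff' measurableSet_Ioo

instance : IsFiniteMeasure volI := ⟨by simp [volI, I]⟩

theorem ae_mem_I : ∀ᵐ x ∂volI, x ∈ I := ae_restrict_mem measurableSet_Ioo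

theorem integrable_volI_iff {F : ℝ → ℝ} :
    Integrable F volI ↔ IntervalIntegrable F volume (-1) 1 := by
  rw [intervalIntegrable_iff_integrableOn_Ioo_of_le (by norm_num)]; rfl

theorem uIcc_subset_uIcc_neg_one_one {a b : ℝ} (ha : a ∈ Icc (-1 : ℝ) 1) (hb : b ∈ Icc (-1 : ℝ) 1) :
    uIcc a b ⊆ uIcc (-1) 1 := by
  rw [uIcc_of_le (by norm_num : (-1 : ℝ) ≤ 1)]; exact uIcc_subset_Icc ha hb

theorem intervalIntegrable_of_Icc {F : ℝ → ℝ} (hF : IntervalIntegrable F volume (-1) 1) {a b : ℝ}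
    (ha : a ∈ Icc (-1 : ℝ) 1) (hb : b ∈ Icc (-1 : ℝ) 1) : IntervalIntegrable F volume a b :=
  hF.mono_set (uIcc_subset_uIcc_neg_one_one ha hb)

theorem left_mem : (-1 : ℝ) ∈ Icc (-1 : ℝ) 1 := by norm_num
theorem right_mem : (1 : ℝ) ∈ Icc (-1 : ℝ) 1 := by norm_num

namespace MemL2

variable {k l : ℝ → ℝ}

theorem integrable (hk : MemL2 k) : Integrable k volI := MemLp.integrable (by norm_num) hk

theorem intervalIntegrable (hk : MemL2 k) : IntervalIntegrable k volume (-1) 1 :=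
  integrable_volI_iff.1 hk.integrable

theorem intervalIntegrable' (hk : MemL2 k) {a b : ℝ}
    (ha : a ∈ Icc (-1 : ℝ) 1) (hb : b ∈ Icc (-1 : ℝ) 1) : IntervalIntegrable k volume a b :=
  intervalIntegrable_of_Icc hk.intervalIntegrable ha hb

theorem add (hk : MemL2 k) (hl : MemL2 l) : MemL2 (k + l) := MemLp.add hk hl
theorem sub (hk : MemL2 k) (hl : MemL2 l) : MemL2 (k - l) := MemLp.sub hk hl
theorem neg (hk : MemL2 k) : MemL2 (-k) := MemLp.neg hk
theorem const_smul (hk : MemL2 k) (c : ℝ) : MemL2 (c • k) := MemLp.const_smul hk c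
theorem congr (hk : MemL2 k) (h : k =ᵐ[volI] l) : MemL2 l := (memLp_congr_ae h).1 hk

theorem integrable_mul (hk : MemL2 k) (hl : MemL2 l) : Integrable (fun x => k x * l x) volI :=
  MemLp.integrable_mul hk hl

theorem integrable_sq (hk : MemL2 k) : Integrable (fun x => k x ^ 2) volI :=
  MemLp.integrable_sq hk

end MemL2

theorem memL2_const (c : ℝ) : MemL2 (fun _ => c) := memLp_const c

theorem memL2_of_continuousOn {k : ℝ → ℝ} (hk : ContinuousOn k (Icc (-1) 1)) : MemL2 k := by
  have hm : AEStronglyMeasurable k volI :=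
    (hk.mono Ioo_subset_Icc_self).aestronglyMeasurable measurableSet_Ioo
  obtain ⟨C, hC⟩ := isCompact_Icc.exists_bound_of_continuousOn hk
  refine MemLp.of_bound hm C ?_
  filter_upwards [ae_mem_I] with x hx using hC x (Ioo_subset_Icc_self hx)

/-- The primitive of `k` that vanishes at `-1`. -/
noncomputable def prim (k : ℝ → ℝ) (x : ℝ) : ℝ := ∫ t in (-1 : ℝ)..x, k t

@[simp] theorem prim_left (k : ℝ → ℝ) : prim k (-1) = 0 := by simp [prim]

section

variable {k l : ℝ → ℝ} {x y : ℝ}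

theorem prim_sub_prim (hk : IntervalIntegrable k volume (-1) 1) (hx : x ∈ Icc (-1 : ℝ) 1)
    (hy : y ∈ Icc (-1 : ℝ) 1) : prim k y - prim k x = ∫ t in x..y, k t :=
  intervalIntegral.integral_interval_sub_left (intervalIntegrable_of_Icc hk left_mem hy)
    (intervalIntegrable_of_Icc hk left_mem hx)

theorem prim_add (hk : IntervalIntegrable k volume (-1) 1)
    (hl : IntervalIntegrable l volume (-1) 1) (hx : x ∈ Icc (-1 : ℝ) 1) :
    prim (k + l) x = prim k x + prim l x :=
  intervalIntegral.integral_add (intervalIntegrable_of_Icc hk left_mem hx)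
    (intervalIntegrable_of_Icc hl left_mem hx)

theorem prim_sub (hk : IntervalIntegrable k volume (-1) 1)
    (hl : IntervalIntegrable l volume (-1) 1) (hx : x ∈ Icc (-1 : ℝ) 1) :
    prim (k - l) x = prim k x - prim l x :=
  intervalIntegral.integral_sub (intervalIntegrable_of_Icc hk left_mem hx)
    (intervalIntegrable_of_Icc hl left_mem hx)

theorem prim_const_smul (c : ℝ) (k : ℝ → ℝ) (x : ℝ) : prim (c • k) x = c * prim k x := by
  simp [prim]

theorem prim_congr (h : k =ᵐ[volI] l) (hx : x ∈ Icc (-1 : ℝ) 1) : prim k x = prim l x := by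
  apply intervalIntegral.integral_congr_ae
  -- `volI` lives on the open interval, so the right end point of the half-open domain of
  -- integration must be discarded separately.
  have h1 : ∀ᵐ t : ℝ, t ≠ 1 := by simp [ae_iff, measure_singleton]
  filter_upwards [ae_volI_iff.1 h, h1] with t ht ht1 htx
  rw [uIoc_of_le hx.1] at htx
  exact ht ⟨htx.1, lt_of_le_of_ne (htx.2.trans hx.2) ht1⟩

theorem prim_eqOn (h : EqOn k l (Icc (-1) 1)) (hx : x ∈ Icc (-1 : ℝ) 1) : prim k x = prim l x :=
  prim_congr (by filter_upwards [ae_mem_I] with t ht using h (Ioo_subset_Icc_self ht)) hx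

theorem absolutelyContinuous_prim (hk : IntervalIntegrable k volume (-1) 1) :
    AbsolutelyContinuousOnInterval (prim k) (-1) 1 :=
  hk.absolutelyContinuousOnInterval_intervalIntegral left_mem_uIcc

theorem continuousOn_prim (hk : IntervalIntegrable k volume (-1) 1) :
    ContinuousOn (prim k) (Icc (-1) 1) := by
  have := (absolutelyContinuous_prim hk).continuousOn
  rwa [uIcc_of_le (by norm_num)] at this

theorem ae_deriv_prim (hk : IntervalIntegrable k volume (-1) 1) :
    ∀ᵐ x, x ∈ Icc (-1 : ℝ) 1 → HasDerivAt (prim k) (k x) x := by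
  filter_upwards [hk.ae_hasDerivAt_integral] with x hx hxI
  rw [uIcc_of_le (by norm_num)] at hx
  exact hx hxI _ left_mem

/-- Integration by parts against a primitive. -/
theorem integral_mul_prim {F : ℝ → ℝ} (hF : AbsolutelyContinuousOnInterval F (-1) 1)
    (hk : IntervalIntegrable k volume (-1) 1) :
    ∫ x in (-1 : ℝ)..1, F x * k x = F 1 * prim k 1 - ∫ x in (-1 : ℝ)..1, deriv F x * prim k x := by
  have := hF.integral_mul_deriv_eq_deriv_mul (absolutelyContinuous_prim hk)
  rw [prim_left, mul_zero, sub_zero] at this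
  rw [← this]
  apply intervalIntegral.integral_congr_ae
  filter_upwards [ae_deriv_prim hk] with x hx hxI
  rw [uIoc_of_le (by norm_num)] at hxI
  rw [(hx (Ioc_subset_Icc_self hxI)).deriv]

theorem integral_prim_mul_prim (hk : IntervalIntegrable k volume (-1) 1)
    (hl : IntervalIntegrable l volume (-1) 1) :
    ∫ x in (-1 : ℝ)..1, prim l x * k x =
      prim l 1 * prim k 1 - ∫ x in (-1 : ℝ)..1, l x * prim k x := by
  rw [integral_mul_prim (absolutelyContinuous_prim hl) hk]
  congr 1
  apply intervalIntegral.integral_congr_ae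
  filter_upwards [ae_deriv_prim hl] with x hx hxI
  rw [uIoc_of_le (by norm_num)] at hxI
  rw [(hx (Ioc_subset_Icc_self hxI)).deriv]

end

/-! ### Norms -/

theorem normL2_nonneg (k : ℝ → ℝ) : 0 ≤ normL2 k := Real.sqrt_nonneg _

theorem normL2_sq (k : ℝ → ℝ) : normL2 k ^ 2 = ∫ x, k x ^ 2 ∂volI :=
  Real.sq_sqrt (integral_nonneg fun _ => sq_nonneg _)

theorem normL2_congr {k l : ℝ → ℝ} (h : k =ᵐ[volI] l) : normL2 k = normL2 l := by
  unfold normL2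
  rw [integral_congr_ae (g := fun x => l x ^ 2) (h.mono fun x hx => by simp only [hx])]

/-- Cauchy–Schwarz against the constant `1`: expand the nonnegative integral of `(|k| - c)²` with
`c` the mean of `|k|`. -/
theorem intervalIntegral_abs_sq_le {k : ℝ → ℝ} {a b : ℝ} (hab : a ≤ b)
    (hk : IntervalIntegrable k volume a b)
    (hk2 : IntervalIntegrable (fun x => k x ^ 2) volume a b) :
    (∫ x in a..b, |k x|) ^ 2 ≤ (b - a) * ∫ x in a..b, k x ^ 2 := by
  rcases hab.eq_or_lt with rfl | hab
  · simp
  have hpos : 0 < b - a := by linarith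
  set A := ∫ x in a..b, |k x| with hA
  set c := A / (b - a)
  have h0 : 0 ≤ ∫ x in a..b, (|k x| - c) ^ 2 :=
    intervalIntegral.integral_nonneg hab.le fun _ _ => sq_nonneg _
  have h1 : ∫ x in a..b, (|k x| - c) ^ 2
      = (∫ x in a..b, k x ^ 2) - 2 * c * A + c ^ 2 * (b - a) := by
    have : ∀ x, (|k x| - c) ^ 2 = k x ^ 2 - (2 * c) * |k x| + c ^ 2 := fun x => by
      rw [sub_sq, sq_abs]; ring
    simp_rw [this]
    rw [intervalIntegral.integral_add (hk2.sub (hk.abs.const_mul _)) (by simp),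
      intervalIntegral.integral_sub hk2 (hk.abs.const_mul _),
      intervalIntegral.integral_const_mul]
    simp [hA]; ring
  have h2 : c * (b - a) = A := div_mul_cancel₀ _ hpos.ne'
  rw [h1] at h0
  nlinarith [mul_nonneg hpos.le h0]

theorem MemL2.intervalIntegrable_sq {k : ℝ → ℝ} (hk : MemL2 k) :
    IntervalIntegrable (fun x => k x ^ 2) volume (-1) 1 :=
  integrable_volI_iff.1 hk.integrable_sq

theorem MemL2.integral_abs_le {k : ℝ → ℝ} (hk : MemL2 k) {a b : ℝ} (ha : a ∈ Icc (-1 : ℝ) 1)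
    (hb : b ∈ Icc (-1 : ℝ) 1) (hab : a ≤ b) :
    ∫ x in a..b, |k x| ≤ Real.sqrt (b - a) * normL2 k := by
  have h1 := intervalIntegral_abs_sq_le hab (hk.intervalIntegrable' ha hb)
    (intervalIntegrable_of_Icc hk.intervalIntegrable_sq ha hb)
  have h2 : ∫ x in a..b, k x ^ 2 ≤ ∫ x, k x ^ 2 ∂volI := by
    rw [integral_volI]
    exact intervalIntegral.integral_mono_interval ha.1 hab hb.2
      (Filter.Eventually.of_forall fun _ => sq_nonneg _) hk.intervalIntegrable_sq
  rw [normL2, ← Real.sqrt_mul (by linarith)]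
  refine Real.le_sqrt_of_sq_le (h1.trans ?_)
  exact mul_le_mul_of_nonneg_left h2 (by linarith)

theorem abs_prim_le {k : ℝ → ℝ} (hk : MemL2 k) {x : ℝ} (hx : x ∈ Icc (-1 : ℝ) 1) :
    |prim k x| ≤ 2 * normL2 k := by
  have h1 : |prim k x| ≤ ∫ t in (-1 : ℝ)..x, |k t| :=
    intervalIntegral.abs_integral_le_integral_abs hx.1
  refine h1.trans ((hk.integral_abs_le left_mem hx hx.1).trans ?_)
  refine mul_le_mul_of_nonneg_right ?_ (normL2_nonneg _)
  rw [Real.sqrt_le_left (by norm_num)]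
  linarith [hx.2]

theorem normL2_le_of_bound {k : ℝ → ℝ} {C : ℝ} (hC : 0 ≤ C) (h : ∀ x ∈ Icc (-1 : ℝ) 1, |k x| ≤ C) :
    normL2 k ≤ 2 * C := by
  rw [normL2, Real.sqrt_le_left (by positivity), integral_volI]
  have : ‖∫ x in (-1 : ℝ)..1, k x ^ 2‖ ≤ C ^ 2 * |1 - (-1)| := by
    apply intervalIntegral.norm_integral_le_of_norm_le_const
    intro x hx
    rw [uIoc_of_le (by norm_num)] at hx
    rw [Real.norm_eq_abs, abs_pow]
    exact pow_le_pow_left₀ (abs_nonneg _) (h x (Ioc_subset_Icc_self hx)) 2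
  rw [Real.norm_eq_abs] at this
  norm_num at this
  nlinarith [le_abs_self (∫ x in (-1 : ℝ)..1, k x ^ 2), sq_nonneg C]

/-! ### The solution operator of `y'' = k`, `y(-1) = y(1) = 0` -/

/-- The primitive of `k` with vanishing mean. -/
noncomputable def mzPrim (k : ℝ → ℝ) (x : ℝ) : ℝ := prim k x - 1 / 2 * prim (prim k) 1

/-- The solution of `y'' = k` with `y(-1) = y(1) = 0`. -/
noncomputable def dirSol (k : ℝ → ℝ) : ℝ → ℝ := prim (mzPrim k)

section

variable {k l : ℝ → ℝ} {x : ℝ}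

theorem MemL2.memL2_prim (hk : MemL2 k) : MemL2 (prim k) :=
  memL2_of_continuousOn (continuousOn_prim hk.intervalIntegrable)

theorem MemL2.continuousOn_mzPrim (hk : MemL2 k) : ContinuousOn (mzPrim k) (Icc (-1) 1) :=
  (continuousOn_prim hk.intervalIntegrable).sub continuousOn_const

theorem MemL2.memL2_mzPrim (hk : MemL2 k) : MemL2 (mzPrim k) :=
  memL2_of_continuousOn hk.continuousOn_mzPrim

theorem MemL2.continuousOn_dirSol (hk : MemL2 k) : ContinuousOn (dirSol k) (Icc (-1) 1) :=
  continuousOn_prim hk.memL2_mzPrim.intervalIntegrable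

theorem MemL2.memL2_dirSol (hk : MemL2 k) : MemL2 (dirSol k) :=
  memL2_of_continuousOn hk.continuousOn_dirSol

@[simp] theorem dirSol_left : dirSol k (-1) = 0 := prim_left _

/-- `mzPrim` subtracts the mean of `prim k` over an interval of length `2`, so its own primitive
returns to `0` at `1`. -/
theorem MemL2.dirSol_right (hk : MemL2 k) : dirSol k 1 = 0 := by
  have : prim (mzPrim k) 1 = prim (prim k) 1 - prim (fun _ => 1 / 2 * prim (prim k) 1) 1 :=
    prim_sub hk.memL2_prim.intervalIntegrable (by simp) right_mem
  rw [dirSol, this]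
  simp [prim]; ring

theorem MemL2.integral_mzPrim (hk : MemL2 k) : ∫ x in (-1 : ℝ)..1, mzPrim k x = 0 :=
  hk.dirSol_right

theorem mzPrim_add (hk : MemL2 k) (hl : MemL2 l) (hx : x ∈ Icc (-1 : ℝ) 1) :
    mzPrim (k + l) x = mzPrim k x + mzPrim l x := by
  have h : prim (prim (k + l)) 1 = prim (prim k + prim l) 1 :=
    prim_eqOn (fun t ht => prim_add hk.intervalIntegrable hl.intervalIntegrable ht) right_mem
  rw [prim_add hk.memL2_prim.intervalIntegrable hl.memL2_prim.intervalIntegrable right_mem] at h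
  simp only [mzPrim]
  rw [h, prim_add hk.intervalIntegrable hl.intervalIntegrable hx]; ring

theorem mzPrim_const_smul (c : ℝ) (k : ℝ → ℝ) (x : ℝ) : mzPrim (c • k) x = c * mzPrim k x := by
  have : prim (c • k) = c • prim k := by ext; simp [prim_const_smul]
  simp only [mzPrim]
  rw [this, prim_const_smul]
  simp only [Pi.smul_apply, smul_eq_mul]; ring

theorem mzPrim_sub (hk : MemL2 k) (hl : MemL2 l) (hx : x ∈ Icc (-1 : ℝ) 1) :
    mzPrim (k - l) x = mzPrim k x - mzPrim l x := by
  have := mzPrim_add hk (hl.const_smul (-1)) hx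
  rw [mzPrim_const_smul, neg_one_smul, ← sub_eq_add_neg] at this
  rw [this]; ring

theorem mzPrim_congr (h : k =ᵐ[volI] l) (hx : x ∈ Icc (-1 : ℝ) 1) : mzPrim k x = mzPrim l x := by
  simp only [mzPrim]
  rw [prim_congr h hx, prim_eqOn (fun t ht => prim_congr h ht) right_mem]

theorem dirSol_congr (h : k =ᵐ[volI] l) (hx : x ∈ Icc (-1 : ℝ) 1) : dirSol k x = dirSol l x :=
  prim_eqOn (fun _ ht => mzPrim_congr h ht) hx

theorem dirSol_add (hk : MemL2 k) (hl : MemL2 l) (hx : x ∈ Icc (-1 : ℝ) 1) :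
    dirSol (k + l) x = dirSol k x + dirSol l x :=
  (prim_eqOn (fun _ ht => mzPrim_add hk hl ht) hx).trans
    (prim_add hk.memL2_mzPrim.intervalIntegrable hl.memL2_mzPrim.intervalIntegrable hx)

theorem dirSol_const_smul (c : ℝ) (k : ℝ → ℝ) (x : ℝ) : dirSol (c • k) x = c * dirSol k x := by
  have : mzPrim (c • k) = c • mzPrim k := by ext; simp [mzPrim_const_smul]
  rw [dirSol, this, prim_const_smul]; rfl

theorem dirSol_sub (hk : MemL2 k) (hl : MemL2 l) (hx : x ∈ Icc (-1 : ℝ) 1) :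
    dirSol (k - l) x = dirSol k x - dirSol l x :=
  (prim_eqOn (fun _ ht => mzPrim_sub hk hl ht) hx).trans
    (prim_sub hk.memL2_mzPrim.intervalIntegrable hl.memL2_mzPrim.intervalIntegrable hx)

/-- Crude constants: `prim k` costs `2`, its `L₂` norm `4`, and half the primitive of `prim k` at
`1` another `4`. -/
theorem abs_mzPrim_le (hk : MemL2 k) (hx : x ∈ Icc (-1 : ℝ) 1) : |mzPrim k x| ≤ 6 * normL2 k := by
  have h1 := abs_prim_le hk hx
  have h2 := abs_prim_le hk.memL2_prim right_mem
  have h3 := normL2_le_of_bound (by have := normL2_nonneg k; positivity)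
    (fun x hx => abs_prim_le hk hx)
  have : |mzPrim k x| ≤ |prim k x| + 1 / 2 * |prim (prim k) 1| := by
    rw [mzPrim]
    refine (abs_sub _ _).trans ?_
    rw [abs_mul]; norm_num
  linarith

theorem normL2_mzPrim_le (hk : MemL2 k) : normL2 (mzPrim k) ≤ 12 * normL2 k := by
  have := normL2_le_of_bound (by have := normL2_nonneg k; positivity)
    (fun x hx => abs_mzPrim_le hk hx)
  linarith

theorem normL2_dirSol_le (hk : MemL2 k) : normL2 (dirSol k) ≤ 48 * normL2 k := by
  have := normL2_le_of_bound (by have := normL2_nonneg (mzPrim k); positivity)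
    (fun x hx => abs_prim_le hk.memL2_mzPrim hx)
  have h2 := normL2_mzPrim_le hk
  have : normL2 (dirSol k) ≤ 2 * (2 * normL2 (mzPrim k)) := this
  linarith

end

/-! ### Weak derivatives -/

theorem Integrable.locallyIntegrableOn_I {k : ℝ → ℝ} (hk : Integrable k volI) :
    LocallyIntegrableOn k I :=
  IntegrableOn.locallyIntegrableOn hk

theorem I_eq_ball : I = Metric.ball (0 : ℝ) 1 := by
  rw [Real.ball_eq_Ioo]; norm_num [I]

theorem integral_volI_eq_integral {F : ℝ → ℝ} (hF : ∀ x, x ∉ I → F x = 0) :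
    ∫ x, F x ∂volI = ∫ x, F x :=
  setIntegral_eq_integral_of_forall_compl_eq_zero hF

theorem eq_zero_of_tsupport_subset {φ : ℝ → ℝ} (h : tsupport φ ⊆ I) {x : ℝ} (hx : x ∉ I) :
    φ x = 0 :=
  image_eq_zero_of_notMem_tsupport fun hx' => hx (h hx')

theorem integrable_mul_of_tsupport_subset {k φ : ℝ → ℝ} (hk : LocallyIntegrableOn k I)
    (hφ : Continuous φ) (hc : HasCompactSupport φ) (hs : tsupport φ ⊆ I) :
    Integrable (fun x => k x * φ x) := by
  have h1 : IntegrableOn k (tsupport φ) := hk.integrableOn_compact_subset hs hc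
  have h2 : IntegrableOn (fun x => k x * φ x) (tsupport φ) :=
    h1.mul_continuousOn hφ.continuousOn hc
  rwa [integrableOn_iff_integrable_of_support_subset] at h2
  intro x hx
  exact subset_tsupport φ (fun h0 => hx (by simp [h0]))

theorem ae_eq_of_forall_integral_mul_eq {k l : ℝ → ℝ} (hk : LocallyIntegrableOn k I)
    (hl : LocallyIntegrableOn l I)
    (h : ∀ φ : ℝ → ℝ, ContDiff ℝ ∞ φ → HasCompactSupport φ → tsupport φ ⊆ I →
      ∫ x, k x * φ x ∂volI = ∫ x, l x * φ x ∂volI) : k =ᵐ[volI] l := by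
  have := isOpen_Ioo.ae_eq_zero_of_integral_contDiff_smul_eq_zero (μ := volume) (hk.sub hl) (by
    intro φ h1 h2 h3
    have hi := h φ h1 h2 h3
    rw [integral_volI_eq_integral, integral_volI_eq_integral, ← sub_eq_zero, ← integral_sub] at hi
    · rw [← hi]
      congr 1; ext x; simp; ring
    · exact integrable_mul_of_tsupport_subset hk h1.continuous h2 h3
    · exact integrable_mul_of_tsupport_subset hl h1.continuous h2 h3
    · intro x hx; rw [eq_zero_of_tsupport_subset h3 hx, mul_zero]
    · intro x hx; rw [eq_zero_of_tsupport_subset h3 hx, mul_zero])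
  refine ae_volI_iff.2 ?_
  filter_upwards [this] with x hx hxI
  simpa [sub_eq_zero] using hx hxI

theorem IsWeakDeriv.ae_eq {y k l : ℝ → ℝ} (hk : IsWeakDeriv y k) (hl : IsWeakDeriv y l) :
    k =ᵐ[volI] l := by
  refine ae_eq_of_forall_integral_mul_eq hk.2.1 hl.2.1 fun φ h1 h2 h3 => ?_
  have := (hk.2.2 φ h1 h2 h3).symm.trans (hl.2.2 φ h1 h2 h3)
  linarith

theorem weakDeriv_ae_eq {y k : ℝ → ℝ} (hk : IsWeakDeriv y k) : weakDeriv y =ᵐ[volI] k := by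
  have h : ∃ k, IsWeakDeriv y k := ⟨k, hk⟩
  rw [weakDeriv, dif_pos h]
  exact h.choose_spec.ae_eq hk

theorem absolutelyContinuous_of_contDiff {φ : ℝ → ℝ} (hφ : ContDiff ℝ ∞ φ) :
    AbsolutelyContinuousOnInterval φ (-1) 1 :=
  ContDiffOn.absolutelyContinuousOnInterval (hφ.of_le (by exact_mod_cast le_top)).contDiffOn

theorem left_notMem_I : (-1 : ℝ) ∉ I := by simp [I]
theorem right_notMem_I : (1 : ℝ) ∉ I := by simp [I]

theorem integral_prim_mul_deriv {k φ : ℝ → ℝ} (hk : Integrable k volI) (c : ℝ)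
    (hφ : ContDiff ℝ ∞ φ) (hs : tsupport φ ⊆ I) :
    ∫ x, (c + prim k x) * deriv φ x ∂volI = -∫ x, k x * φ x ∂volI := by
  have hac := absolutelyContinuous_of_contDiff hφ
  have hk' := integrable_volI_iff.1 hk
  have h1 := integral_mul_prim hac hk'
  have h2 := hac.integral_deriv_eq_sub
  rw [eq_zero_of_tsupport_subset hs right_notMem_I] at h1 h2
  rw [eq_zero_of_tsupport_subset hs left_notMem_I] at h2
  have hd : IntervalIntegrable (deriv φ) volume (-1) 1 := hac.intervalIntegrable_deriv
  have hpd : IntervalIntegrable (fun x => deriv φ x * prim k x) volume (-1) 1 :=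
    hd.mul_continuousOn (absolutelyContinuous_prim hk').continuousOn
  rw [integral_volI, integral_volI]
  have e1 : ∫ x in (-1 : ℝ)..1, (c + prim k x) * deriv φ x
      = ∫ x in (-1 : ℝ)..1, (c * deriv φ x + deriv φ x * prim k x) := by
    congr 1; ext x; ring
  have e2 : ∫ x in (-1 : ℝ)..1, k x * φ x = ∫ x in (-1 : ℝ)..1, φ x * k x := by
    congr 1; ext x; ring
  rw [e1, e2, intervalIntegral.integral_add (hd.const_mul c) hpd,
    intervalIntegral.integral_const_mul, h2, h1]
  ring

theorem isWeakDeriv_prim {y k : ℝ → ℝ} (hk : Integrable k volI) (c : ℝ)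
    (h : y =ᵐ[volI] fun x => c + prim k x) : IsWeakDeriv y k := by
  have hp : Integrable (fun x => c + prim k x) volI :=
    (integrable_const c).add (memL2_of_continuousOn
      (continuousOn_prim (integrable_volI_iff.1 hk))).integrable
  refine ⟨Integrable.locallyIntegrableOn_I ((integrable_congr h).2 hp),
    Integrable.locallyIntegrableOn_I hk, fun φ h1 h2 h3 => ?_⟩
  rw [← integral_prim_mul_deriv hk c h1 h3]
  apply integral_congr_ae
  filter_upwards [h] with x hx
  rw [hx]

/-- A test function with vanishing integral is the derivative of a test function. -/
theorem exists_testFunction_deriv_eq {θ : ℝ → ℝ} (hθ : ContDiff ℝ ∞ θ) (hs : tsupport θ ⊆ I)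
    (h0 : ∫ x in (-1 : ℝ)..1, θ x = 0) :
    ∃ φ : ℝ → ℝ, ContDiff ℝ ∞ φ ∧ HasCompactSupport φ ∧ tsupport φ ⊆ I ∧ deriv φ = θ := by
  have hcont := hθ.continuous
  have hd : ∀ x, HasDerivAt (prim θ) (θ x) x := fun x => hcont.integral_hasStrictDerivAt _ x
    |>.hasDerivAt
  have hderiv : deriv (prim θ) = θ := funext fun x => (hd x).deriv
  rw [I_eq_ball] at hs
  -- The support of `θ` stays at a positive distance from `±1`. The primitive vanishes to its left
  -- since nothing has been integrated yet, and to its right since the total integral is `0`.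
  obtain ⟨r, hr1, hr⟩ := exists_lt_subset_ball (isClosed_tsupport θ) hs
  have hz : ∀ x, r ≤ |x| → θ x = 0 := fun x hx =>
    image_eq_zero_of_notMem_tsupport fun h => by
      have := hr h
      rw [Metric.mem_ball, Real.dist_eq, sub_zero] at this
      linarith
  have hsupp : Function.support (prim θ) ⊆ Metric.closedBall 0 r := by
    intro x hx
    by_contra hxr
    rw [Metric.mem_closedBall, Real.dist_eq, sub_zero, not_le] at hxr
    apply hx
    rcases le_total 0 x with h | h
    · rw [abs_of_nonneg h] at hxr
      rw [prim, ← intervalIntegral.integral_add_adjacent_intervals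
        (hcont.intervalIntegrable (-1) 1) (hcont.intervalIntegrable 1 x), h0, zero_add]
      refine intervalIntegral.integral_zero_ae (Filter.Eventually.of_forall fun t ht => hz t ?_)
      have h1 : r ≤ t := by
        have := (uIoc_subset_uIcc ht)
        rw [mem_uIcc] at this
        rcases this with h | h <;> linarith
      exact h1.trans (le_abs_self t)
    · rw [abs_of_nonpos h] at hxr
      rw [prim]
      refine intervalIntegral.integral_zero_ae (Filter.Eventually.of_forall fun t ht => hz t ?_)
      have h1 : r ≤ -t := by
        have := (uIoc_subset_uIcc ht)
        rw [mem_uIcc] at this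
        rcases this with h | h <;> linarith
      exact h1.trans (neg_le_abs t)
  refine ⟨prim θ, ?_, HasCompactSupport.of_support_subset_isCompact
    (isCompact_closedBall 0 r) hsupp, ?_, hderiv⟩
  · rw [contDiff_infty_iff_deriv]
    exact ⟨fun x => (hd x).differentiableAt, by rwa [hderiv]⟩
  · rw [I_eq_ball]
    exact (closure_minimal hsupp Metric.isClosed_closedBall).trans
      (Metric.closedBall_subset_ball hr1)

theorem exists_testFunction_integral_eq_one :
    ∃ η : ℝ → ℝ, ContDiff ℝ ∞ η ∧ HasCompactSupport η ∧ tsupport η ⊆ I ∧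
      ∫ x in (-1 : ℝ)..1, η x = 1 := by
  let b : ContDiffBump (0 : ℝ) := ⟨1 / 4, 1 / 2, by norm_num, by norm_num⟩
  have hs : tsupport (b.normed volume) ⊆ I := by
    rw [b.tsupport_normed_eq, I_eq_ball]
    exact Metric.closedBall_subset_ball (by norm_num)
  refine ⟨b.normed volume, b.contDiff_normed, b.hasCompactSupport_normed, hs, ?_⟩
  rw [← integral_volI, integral_volI_eq_integral fun x hx => eq_zero_of_tsupport_subset hs hx]
  exact b.integral_normed

/-- The lemma of du Bois-Reymond. -/
theorem ae_eq_const_of_integral_mul_deriv_eq_zero {k : ℝ → ℝ} (hk : LocallyIntegrableOn k I)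
    (h : ∀ φ : ℝ → ℝ, ContDiff ℝ ∞ φ → HasCompactSupport φ → tsupport φ ⊆ I →
      ∫ x, k x * deriv φ x ∂volI = 0) : ∃ c : ℝ, k =ᵐ[volI] fun _ => c := by
  obtain ⟨η, η1, η2, η3, η4⟩ := exists_testFunction_integral_eq_one
  refine ⟨∫ x, k x * η x ∂volI, ae_eq_of_forall_integral_mul_eq hk
    (locallyIntegrableOn_const _) fun χ χ1 χ2 χ3 => ?_⟩
  -- Subtracting `a • η` gives the test function mean zero, so it is the derivative of a test
  -- function and the hypothesis applies.
  set a := ∫ x in (-1 : ℝ)..1, χ x with ha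
  have hsub : tsupport (χ - a • η) ⊆ I := by
    refine (tsupport_sub χ (a • η)).trans (union_subset χ3 ?_)
    exact (tsupport_smul_subset_right (fun _ => a) η).trans η3
  obtain ⟨φ, φ1, φ2, φ3, φ4⟩ := exists_testFunction_deriv_eq (θ := χ - a • η)
    (χ1.sub (η1.const_smul a)) hsub (by
      simp only [Pi.sub_apply, Pi.smul_apply, smul_eq_mul]
      rw [intervalIntegral.integral_sub (χ1.continuous.intervalIntegrable _ _)
        ((η1.continuous.intervalIntegrable _ _).const_mul a),
        intervalIntegral.integral_const_mul, η4]
      simp [ha])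
  have h0 := h φ φ1 φ2 φ3
  rw [φ4] at h0
  have e : ∀ x, k x * (χ - a • η) x = k x * χ x - a * (k x * η x) := fun x => by
    simp; ring
  simp_rw [e] at h0
  have i1 : Integrable (fun x => k x * χ x) volI :=
    (integrable_mul_of_tsupport_subset hk χ1.continuous χ2 χ3).integrableOn
  have i2 : Integrable (fun x => k x * η x) volI :=
    (integrable_mul_of_tsupport_subset hk η1.continuous η2 η3).integrableOn
  rw [integral_sub i1 (i2.const_mul a), integral_const_mul] at h0
  rw [integral_const_mul, integral_volI χ, ← ha]
  linarith

/-- `y - prim k` has weak derivative zero, so the du Bois-Reymond lemma makes it constant. -/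
theorem IsWeakDeriv.ae_eq_prim {y k : ℝ → ℝ} (h : IsWeakDeriv y k) (hk : Integrable k volI) :
    ∃ c : ℝ, y =ᵐ[volI] fun x => c + prim k x := by
  have hp : IsWeakDeriv (prim k) k := isWeakDeriv_prim hk 0 (by simp)
  obtain ⟨c, hc⟩ := ae_eq_const_of_integral_mul_deriv_eq_zero (h.1.sub hp.1)
    (fun φ h1 h2 h3 => by
      have hd : Continuous (deriv φ) := h1.continuous_deriv (by simp)
      have hs : tsupport (deriv φ) ⊆ I := fun x hx => h3 (tsupport_deriv_subset hx)
      have i1 := integrable_mul_of_tsupport_subset h.1 hd h2.deriv hs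
      have i2 := integrable_mul_of_tsupport_subset hp.1 hd h2.deriv hs
      simp only [Pi.sub_apply, sub_mul]
      rw [integral_sub (μ := volI) i1.integrableOn i2.integrableOn, h.2.2 φ h1 h2 h3, hp.2.2 φ h1 h2 h3,
        sub_self])
  refine ⟨c, ?_⟩
  filter_upwards [hc] with x hx
  have : y x - prim k x = c := hx
  linarith

/-! ### The space `V` -/

theorem eqOn_of_ae_eq {f g : ℝ → ℝ} (h : f =ᵐ[volI] g) (hf : ContinuousOn f (Icc (-1) 1))
    (hg : ContinuousOn g (Icc (-1) 1)) : EqOn f g (Icc (-1) 1) := by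
  refine Measure.eqOn_Icc_of_ae_eq volume (by norm_num) ?_ hf hg
  rw [← restrict_Ioo_eq_restrict_Icc]; exact h

/-- The equality version applied to `min f g` and `f`. -/
theorem le_of_ae_le {f g : ℝ → ℝ} (h : f ≤ᵐ[volI] g) (hf : ContinuousOn f (Icc (-1) 1))
    (hg : ContinuousOn g (Icc (-1) 1)) {x : ℝ} (hx : x ∈ Icc (-1 : ℝ) 1) : f x ≤ g x := by
  have : EqOn (fun x => min (f x) (g x)) f (Icc (-1) 1) :=
    eqOn_of_ae_eq (h.mono fun x hx => min_eq_left hx) (ContinuousOn.inf hf hg) hf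
  exact min_eq_left_iff.1 (this hx)

theorem memSobolev_one_iff {y : ℝ → ℝ} :
    MemSobolev 1 y ↔ MemL2 y ∧ ∃ k, IsWeakDeriv y k ∧ MemL2 k := by
  simp [MemSobolev, MemSobolevAux]

theorem memSobolev_two_iff {y : ℝ → ℝ} :
    MemSobolev 2 y ↔
      MemL2 y ∧ ∃ w, IsWeakDeriv y w ∧ MemL2 w ∧ ∃ k, IsWeakDeriv w k ∧ MemL2 k := by
  simp [MemSobolev, MemSobolevAux]

section

variable {y k : ℝ → ℝ}

theorem isWeakDeriv_of_eqOn_dirSol (hk : MemL2 k) (h : EqOn y (dirSol k) (Icc (-1) 1)) :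
    IsWeakDeriv y (mzPrim k) := by
  refine isWeakDeriv_prim hk.memL2_mzPrim.integrable 0 ?_
  filter_upwards [ae_mem_I] with x hx
  rw [h (Ioo_subset_Icc_self hx), zero_add]; rfl

theorem weakDeriv_dirSol (hk : MemL2 k) (h : EqOn y (dirSol k) (Icc (-1) 1)) :
    weakDeriv y =ᵐ[volI] mzPrim k :=
  weakDeriv_ae_eq (isWeakDeriv_of_eqOn_dirSol hk h)

theorem isWeakDeriv_of_ae_eq_mzPrim {w : ℝ → ℝ} (hk : MemL2 k) (h : w =ᵐ[volI] mzPrim k) :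
    IsWeakDeriv w k :=
  isWeakDeriv_prim hk.integrable (-(1 / 2 * prim (prim k) 1)) (h.trans (by
    filter_upwards with x
    rw [mzPrim]; ring))

theorem weakDeriv_two_dirSol (hk : MemL2 k) (h : EqOn y (dirSol k) (Icc (-1) 1)) :
    weakDeriv^[2] y =ᵐ[volI] k :=
  weakDeriv_ae_eq (isWeakDeriv_of_ae_eq_mzPrim hk (weakDeriv_dirSol hk h))

/-- Integrating `k` twice leaves two constants. The condition at `-1` removes the outer one; the
condition at `1` forces the inner one to be minus the mean of `prim k`, as in `mzPrim`. -/
theorem memV_iff : MemV y ↔ ∃ k, MemL2 k ∧ EqOn y (dirSol k) (Icc (-1) 1) := by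
  constructor
  · rintro ⟨hs, hc, h0, h1⟩
    obtain ⟨-, w, hyw, hw, k, hwk, hk⟩ := memSobolev_two_iff.1 hs
    obtain ⟨c₀, hc₀⟩ := hyw.ae_eq_prim hw.integrable
    obtain ⟨c₁, hc₁⟩ := hwk.ae_eq_prim hk.integrable
    have hy : EqOn y (fun x => c₀ + prim w x) (Icc (-1) 1) :=
      eqOn_of_ae_eq hc₀ hc (continuousOn_const.add (continuousOn_prim hw.intervalIntegrable))
    have hc₀ : c₀ = 0 := by
      have := hy left_mem
      simp [h0] at this
      exact this.symm
    have hw1 : ∀ x ∈ Icc (-1 : ℝ) 1, prim w x = c₁ * (x + 1) + prim (prim k) x := fun x hx => by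
      rw [prim_congr hc₁ hx]
      have : prim ((fun _ => c₁) + prim k) x = _ :=
        prim_add (by simp) hk.memL2_prim.intervalIntegrable hx
      refine this.trans ?_
      simp [prim]; ring
    have hc₁' : c₁ = -(1 / 2 * prim (prim k) 1) := by
      have h2 := hy right_mem
      have h3 := hw1 1 right_mem
      simp only [h1, hc₀] at h2
      linarith
    refine ⟨k, hk, fun x hx => ?_⟩
    rw [hy hx]
    simp only [hc₀, zero_add]
    refine prim_congr (hc₁.trans ?_) hx
    filter_upwards with t
    rw [mzPrim, hc₁']; ring
  · rintro ⟨k, hk, h⟩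
    refine ⟨memSobolev_two_iff.2 ⟨?_, mzPrim k, isWeakDeriv_of_eqOn_dirSol hk h,
      hk.memL2_mzPrim, k, isWeakDeriv_of_ae_eq_mzPrim hk (ae_eq_refl _), hk⟩,
      hk.continuousOn_dirSol.congr h, ?_, ?_⟩
    · exact memL2_of_continuousOn (hk.continuousOn_dirSol.congr h)
    · rw [h left_mem, dirSol_left]
    · rw [h right_mem, hk.dirSol_right]

theorem seminormH_one_dirSol (hk : MemL2 k) (h : EqOn y (dirSol k) (Icc (-1) 1)) :
    seminormH 1 y = normL2 (mzPrim k) :=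
  normL2_congr (weakDeriv_dirSol hk h)

theorem seminormH_two_dirSol (hk : MemL2 k) (h : EqOn y (dirSol k) (Icc (-1) 1)) :
    seminormH 2 y = normL2 k :=
  normL2_congr (weakDeriv_two_dirSol hk h)

theorem normL2_congr_Icc {f g : ℝ → ℝ} (h : EqOn f g (Icc (-1) 1)) : normL2 f = normL2 g :=
  normL2_congr (by filter_upwards [ae_mem_I] with x hx using h (Ioo_subset_Icc_self hx))

end

/-! ### Quadratic minimization over closed convex sets -/

/-- The functional is the squared distance from `(d, -√β f)` to the image of `K` under `k ↦ (T k, √β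
k)` in the Hilbert product. This map is bounded below because `β > 0`, so the image is complete as
well as convex, and the projection theorem applies. -/
theorem exists_forall_quadratic_le {E F : Type*} [NormedAddCommGroup E] [InnerProductSpace ℝ E]
    [CompleteSpace E] [NormedAddCommGroup F] [InnerProductSpace ℝ F] (T : E →L[ℝ] F) (d : F)
    (f : E) {β : ℝ} (hβ : 0 < β) {K : Set E} (hK : IsClosed K) (hconv : Convex ℝ K)
    (hne : K.Nonempty) :
    ∃ g ∈ K, ∀ k ∈ K, ‖T g - d‖ ^ 2 + β * ‖g + f‖ ^ 2 ≤ ‖T k - d‖ ^ 2 + β * ‖k + f‖ ^ 2 := by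
  let A : E →ₗ[ℝ] WithLp 2 (F × E) :=
    (WithLp.linearEquiv 2 ℝ (F × E)).symm.toLinearMap ∘ₗ
      (T.toLinearMap.prod (Real.sqrt β • LinearMap.id))
  have hA : ∀ g, A g = WithLp.toLp 2 (T g, Real.sqrt β • g) := fun g => rfl
  have hs : 0 < Real.sqrt β := Real.sqrt_pos.2 hβ
  have hnorm : ∀ g, ‖A g‖ ^ 2 = ‖T g‖ ^ 2 + β * ‖g‖ ^ 2 := fun g => by
    rw [hA, WithLp.prod_norm_sq_eq_of_L2]
    simp [norm_smul, mul_pow, Real.sq_sqrt hβ.le]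
  have hanti : AntilipschitzWith (Real.sqrt β)⁻¹.toNNReal A := by
    refine AddMonoidHomClass.antilipschitz_of_bound A fun g => ?_
    rw [Real.coe_toNNReal _ (inv_nonneg.2 hs.le), ← div_eq_inv_mul, le_div_iff₀ hs]
    refine (pow_le_pow_iff_left₀ (by positivity) (norm_nonneg _) two_ne_zero).1 ?_
    rw [hnorm, mul_pow, Real.sq_sqrt hβ.le]
    nlinarith [sq_nonneg ‖T g‖]
  have hcont : UniformContinuous A := by
    have hc : Continuous A := by
      have : Continuous fun g => WithLp.toLp 2 (T g, Real.sqrt β • g) := by fun_prop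
      exact this
    exact (⟨A, hc⟩ : E →L[ℝ] WithLp 2 (F × E)).uniformContinuous
  have hcompl : IsComplete (A '' K) :=
    (isComplete_image_iff (hanti.isUniformInducing hcont)).2 hK.isComplete
  obtain ⟨v, ⟨g, hg, rfl⟩, hv⟩ := exists_norm_eq_iInf_of_complete_convex (hne.image A) hcompl
    (hconv.linear_image A) (WithLp.toLp 2 (d, -(Real.sqrt β • f)))
  have key : ∀ k, ‖WithLp.toLp 2 (d, -(Real.sqrt β • f)) - A k‖ ^ 2
      = ‖T k - d‖ ^ 2 + β * ‖k + f‖ ^ 2 := fun k => by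
    rw [hA, WithLp.prod_norm_sq_eq_of_L2]
    have h1 : -(Real.sqrt β • f) - Real.sqrt β • k = -(Real.sqrt β • (k + f)) := by
      rw [smul_add]; abel
    have h2 : ‖Real.sqrt β • (k + f)‖ ^ 2 = β * ‖k + f‖ ^ 2 := by
      rw [norm_smul, mul_pow, Real.norm_eq_abs, sq_abs, Real.sq_sqrt hβ.le]
    rw [← h2, ← norm_neg (Real.sqrt β • (k + f)), ← h1, norm_sub_rev (T k)]
    rfl
  refine ⟨g, hg, fun k hk => ?_⟩
  rw [← key, ← key]
  refine pow_le_pow_left₀ (norm_nonneg _) ?_ 2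
  rw [hv]
  exact ciInf_le ⟨0, by rintro _ ⟨_, rfl⟩; positivity⟩
    (⟨A k, mem_image_of_mem A hk⟩ : A '' K)

/-! ### The reduced functional -/

/-- The class of `k` in `L₂(I)`. -/
noncomputable def MemL2.toLp {k : ℝ → ℝ} (hk : MemL2 k) : Lp ℝ 2 volI := MemLp.toLp k hk

section

variable {k l : ℝ → ℝ}

theorem MemL2.coeFn_toLp (hk : MemL2 k) : hk.toLp =ᵐ[volI] k := MemLp.coeFn_toLp hk

theorem MemL2.toLp_congr (hk : MemL2 k) (hl : MemL2 l) (h : k =ᵐ[volI] l) : hk.toLp = hl.toLp :=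
  MemLp.toLp_congr hk hl h

theorem MemL2.toLp_add (hk : MemL2 k) (hl : MemL2 l) : (hk.add hl).toLp = hk.toLp + hl.toLp :=
  MemLp.toLp_add hk hl

theorem MemL2.toLp_sub (hk : MemL2 k) (hl : MemL2 l) : (hk.sub hl).toLp = hk.toLp - hl.toLp :=
  MemLp.toLp_sub hk hl

theorem MemL2.toLp_const_smul (hk : MemL2 k) (c : ℝ) : (hk.const_smul c).toLp = c • hk.toLp :=
  MemLp.toLp_const_smul c hk

theorem MemL2.inner_toLp (hk : MemL2 k) (hl : MemL2 l) :
    inner ℝ hk.toLp hl.toLp = ∫ x, k x * l x ∂volI := by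
  rw [L2.inner_def]
  apply integral_congr_ae
  filter_upwards [hk.coeFn_toLp, hl.coeFn_toLp] with x h1 h2
  rw [h1, h2]; simp [mul_comm]

theorem MemL2.norm_toLp (hk : MemL2 k) : ‖hk.toLp‖ = normL2 k := by
  have h : ‖hk.toLp‖ ^ 2 = normL2 k ^ 2 := by
    rw [← real_inner_self_eq_norm_sq, hk.inner_toLp hk, normL2_sq]
    simp only [sq]
  exact (pow_left_inj₀ (norm_nonneg _) (normL2_nonneg _) (by norm_num)).1 h

end

theorem memL2_coe (g : Lp ℝ 2 volI) : MemL2 g := Lp.memLp g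

theorem toLp_coe (g : Lp ℝ 2 volI) : (memL2_coe g).toLp = g := Lp.toLp_coeFn g _

theorem norm_Lp_eq (g : Lp ℝ 2 volI) : ‖g‖ = normL2 g := by
  rw [← (memL2_coe g).norm_toLp, toLp_coe]

/-- The solution operator as a continuous linear map of `L₂(I)`. -/
noncomputable def dirSolCLM : Lp ℝ 2 volI →L[ℝ] Lp ℝ 2 volI :=
  LinearMap.mkContinuous
    { toFun := fun g => (memL2_coe g).memL2_dirSol.toLp
      map_add' := fun g h => by
        rw [← MemL2.toLp_add]
        refine MemL2.toLp_congr _ _ ?_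
        filter_upwards [ae_mem_I] with x hx
        have hx := Ioo_subset_Icc_self hx
        rw [dirSol_congr (Lp.coeFn_add g h) hx, dirSol_add (memL2_coe g) (memL2_coe h) hx]; rfl
      map_smul' := fun c g => by
        rw [RingHom.id_apply, ← MemL2.toLp_const_smul]
        refine MemL2.toLp_congr _ _ ?_
        filter_upwards [ae_mem_I] with x hx
        have hx := Ioo_subset_Icc_self hx
        rw [dirSol_congr (Lp.coeFn_smul c g) hx, dirSol_const_smul]; rfl }
    48 fun g => by
      change ‖(memL2_coe g).memL2_dirSol.toLp‖ ≤ _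
      rw [MemL2.norm_toLp, norm_Lp_eq]
      exact normL2_dirSol_le (memL2_coe g)

theorem dirSolCLM_apply (g : Lp ℝ 2 volI) :
    dirSolCLM g = (memL2_coe g).memL2_dirSol.toLp := rfl

/-- The point evaluation of `mzPrim` as a continuous linear functional on `L₂(I)`. -/
noncomputable def mzPrimCLM (x : ℝ) (hx : x ∈ Icc (-1 : ℝ) 1) : Lp ℝ 2 volI →L[ℝ] ℝ :=
  LinearMap.mkContinuous
    { toFun := fun g => mzPrim g x
      map_add' := fun g h => by
        rw [mzPrim_congr (Lp.coeFn_add g h) hx, mzPrim_add (memL2_coe g) (memL2_coe h) hx]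
      map_smul' := fun c g => by
        rw [mzPrim_congr (Lp.coeFn_smul c g) hx, mzPrim_const_smul]; rfl }
    6 fun g => by
      rw [norm_Lp_eq]
      exact abs_mzPrim_le (memL2_coe g) hx

theorem isClosed_mzPrim_le {x : ℝ} (hx : x ∈ Icc (-1 : ℝ) 1) (c : ℝ) :
    IsClosed {g : Lp ℝ 2 volI | mzPrim g x ≤ c} :=
  isClosed_le (mzPrimCLM x hx).continuous continuous_const

/-- The reduced functional: twice the cost of `y = dirSol k` and `u = -k - f`. -/
noncomputable def redCost (β : ℝ) (yd f k : ℝ → ℝ) : ℝ :=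
  normL2 (dirSol k - yd) ^ 2 + β * normL2 (k + f) ^ 2

/-- `g` minimizes the reduced functional among the members of `L₂(I)` with property `P`. -/
def IsRedMin (β : ℝ) (yd f : ℝ → ℝ) (P : (ℝ → ℝ) → Prop) (g : ℝ → ℝ) : Prop :=
  MemL2 g ∧ P g ∧ ∀ k, MemL2 k → P k → redCost β yd f g ≤ redCost β yd f k

/-- `P` defines a nonempty closed convex subset of `L₂(I)`. -/
structure IsClosedConvexL2 (P : (ℝ → ℝ) → Prop) : Prop where
  congr : ∀ k l, k =ᵐ[volI] l → P k → P l
  convex : ∀ k l, MemL2 k → MemL2 l → P k → P l → ∀ t : ℝ, 0 ≤ t → t ≤ 1 → P (k + t • (l - k))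
  closed : IsClosed {g : Lp ℝ 2 volI | P g}
  nonempty : ∃ k, MemL2 k ∧ P k

section

variable {β : ℝ} {yd f : ℝ → ℝ} {P : (ℝ → ℝ) → Prop}

theorem redCost_eq_norm (hyd : MemL2 yd) (hf : MemL2 f) (k : Lp ℝ 2 volI) :
    redCost β yd f k = ‖dirSolCLM k - hyd.toLp‖ ^ 2 + β * ‖k + hf.toLp‖ ^ 2 := by
  rw [dirSolCLM_apply, ← MemL2.toLp_sub, norm_Lp_eq (k + _)]
  rw [MemL2.norm_toLp ((memL2_coe k).memL2_dirSol.sub hyd), redCost]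
  congr 3
  apply normL2_congr
  filter_upwards [Lp.coeFn_add k (hf.toLp), hf.coeFn_toLp] with x hx hx'
  rw [hx, Pi.add_apply, Pi.add_apply, hx']

theorem redCost_congr {k l : ℝ → ℝ} (h : k =ᵐ[volI] l) :
    redCost β yd f k = redCost β yd f l := by
  have h1 : normL2 (dirSol k - yd) = normL2 (dirSol l - yd) :=
    normL2_congr_Icc fun x hx => by simp [dirSol_congr h hx]
  have h2 : normL2 (k + f) = normL2 (l + f) :=
    normL2_congr (by filter_upwards [h] with x hx; simp [hx])
  rw [redCost, redCost, h1, h2]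

theorem IsClosedConvexL2.exists_isRedMin (hP : IsClosedConvexL2 P) (hβ : 0 < β) (hyd : MemL2 yd)
    (hf : MemL2 f) : ∃ g, IsRedMin β yd f P g := by
  have hconv : Convex ℝ {g : Lp ℝ 2 volI | P g} := by
    rw [convex_iff_forall_pos]
    intro k hk l hl a b ha hb hab
    refine hP.congr _ _ ?_
      (hP.convex k l (memL2_coe k) (memL2_coe l) hk hl b hb.le (by linarith))
    filter_upwards [Lp.coeFn_add (a • k) (b • l), Lp.coeFn_smul a k, Lp.coeFn_smul b l]
      with x h1 h2 h3
    simp only [h1, Pi.add_apply, h2, h3]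
    obtain rfl : a = 1 - b := by linarith
    simp; ring
  have hmem : ∀ k, (hk : MemL2 k) → P k → hk.toLp ∈ {g : Lp ℝ 2 volI | P g} :=
    fun k hk hPk => hP.congr _ _ (hk.coeFn_toLp).symm hPk
  obtain ⟨k₀, hk₀, hPk₀⟩ := hP.nonempty
  obtain ⟨g, hg, hmin⟩ := exists_forall_quadratic_le dirSolCLM (hyd.toLp)
    (hf.toLp) hβ hP.closed hconv ⟨_, hmem k₀ hk₀ hPk₀⟩
  refine ⟨g, memL2_coe g, hg, fun k hk hPk => ?_⟩
  have := hmin _ (hmem k hk hPk)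
  rw [← redCost_eq_norm hyd hf, ← redCost_eq_norm hyd hf] at this
  exact this.trans_eq (redCost_congr (hk.coeFn_toLp))

/-- The derivative of the reduced functional at `g` in direction `l`, up to a factor `2`. -/
noncomputable def redDeriv (β : ℝ) (yd f g l : ℝ → ℝ) : ℝ :=
  (∫ x, (dirSol g - yd) x * dirSol l x ∂volI) + β * ∫ x, (g + f) x * l x ∂volI

/-- The energy inner product of `dirSol k` and `dirSol l`. -/
noncomputable def energyForm (β : ℝ) (k l : ℝ → ℝ) : ℝ :=
  (∫ x, dirSol k x * dirSol l x ∂volI) + β * ∫ x, k x * l x ∂volI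

theorem energyForm_self (β : ℝ) (k : ℝ → ℝ) :
    energyForm β k k = normL2 (dirSol k) ^ 2 + β * normL2 k ^ 2 := by
  rw [energyForm, normL2_sq, normL2_sq]
  simp only [sq]

theorem normL2_add_smul_sq {a b : ℝ → ℝ} (ha : MemL2 a) (hb : MemL2 b) (t : ℝ) :
    normL2 (a + t • b) ^ 2 = normL2 a ^ 2 + 2 * t * ∫ x, a x * b x ∂volI + t ^ 2 * normL2 b ^ 2 := by
  rw [normL2_sq, normL2_sq, normL2_sq]
  have : ∀ x, (a + t • b) x ^ 2 = a x ^ 2 + 2 * t * (a x * b x) + t ^ 2 * b x ^ 2 := fun x => by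
    simp; ring
  simp_rw [this]
  have hab := (ha.integrable_mul hb).const_mul (2 * t)
  have hs : Integrable (fun x => a x ^ 2 + 2 * t * (a x * b x)) volI := ha.integrable_sq.add hab
  rw [integral_add hs (hb.integrable_sq.const_mul _), integral_add ha.integrable_sq hab,
    integral_const_mul, integral_const_mul]

theorem redCost_add_smul (hyd : MemL2 yd) (hf : MemL2 f) {g l : ℝ → ℝ} (hg : MemL2 g)
    (hl : MemL2 l) (t : ℝ) : redCost β yd f (g + t • l) =
      redCost β yd f g + 2 * t * redDeriv β yd f g l + t ^ 2 * energyForm β l l := by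
  have h1 : normL2 (dirSol (g + t • l) - yd) = normL2 ((dirSol g - yd) + t • dirSol l) :=
    normL2_congr_Icc fun x hx => by
      simp only [Pi.sub_apply, Pi.add_apply, Pi.smul_apply, smul_eq_mul]
      rw [dirSol_add hg (hl.const_smul t) hx, dirSol_const_smul]; ring
  have h2 : g + t • l + f = (g + f) + t • l := by abel
  rw [redCost, h1, h2, normL2_add_smul_sq (hg.memL2_dirSol.sub hyd) hl.memL2_dirSol,
    normL2_add_smul_sq (hg.add hf) hl, redCost, redDeriv, energyForm_self]
  ring

/-- The variational inequality. -/
theorem IsRedMin.redDeriv_nonneg {g k : ℝ → ℝ} (hP : IsClosedConvexL2 P)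
    (hyd : MemL2 yd) (hf : MemL2 f) (hg : IsRedMin β yd f P g) (hk : MemL2 k) (hPk : P k) :
    0 ≤ redDeriv β yd f g (k - g) := by
  have hl := hk.sub hg.1
  have key : ∀ t : ℝ, 0 < t → t ≤ 1 →
      0 ≤ 2 * redDeriv β yd f g (k - g) + t * energyForm β (k - g) (k - g) := fun t ht0 ht1 => by
    have h := hg.2.2 _ (hg.1.add (hl.const_smul t)) (hP.convex g k hg.1 hk hg.2.1 hPk t ht0.le ht1)
    rw [redCost_add_smul hyd hf hg.1 hl] at h
    have : 0 ≤ t * (2 * redDeriv β yd f g (k - g) + t * energyForm β (k - g) (k - g)) := by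
      linarith
    exact nonneg_of_mul_nonneg_right this ht0
  by_contra! hneg
  set r := redDeriv β yd f g (k - g)
  set q := energyForm β (k - g) (k - g)
  rcases le_or_gt q 0 with hq | hq
  · have := key 1 one_pos le_rfl
    linarith
  -- With this step size the quadratic term is at most `-r`, so the sum in `key` is at most `r < 0`.
  · have h := key (min 1 (-r / q)) (by
      refine lt_min one_pos (div_pos (by linarith) hq)) (min_le_left _ _)
    have h2 : min 1 (-r / q) * q ≤ -r := by
      rw [← le_div_iff₀ hq]; exact min_le_right _ _
    linarith

theorem redDeriv_sub_redDeriv (hyd : MemL2 yd) (hf : MemL2 f) {g k l : ℝ → ℝ} (hg : MemL2 g)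
    (hk : MemL2 k) (hl : MemL2 l) :
    redDeriv β yd f k l - redDeriv β yd f g l = energyForm β (k - g) l := by
  have e1 : ∫ x, dirSol (k - g) x * dirSol l x ∂volI
      = (∫ x, (dirSol k - yd) x * dirSol l x ∂volI) - ∫ x, (dirSol g - yd) x * dirSol l x ∂volI := by
    rw [← integral_sub ((hk.memL2_dirSol.sub hyd).integrable_mul hl.memL2_dirSol)
      ((hg.memL2_dirSol.sub hyd).integrable_mul hl.memL2_dirSol)]
    apply integral_congr_ae
    filter_upwards [ae_mem_I] with x hx
    rw [dirSol_sub hk hg (Ioo_subset_Icc_self hx)]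
    simp; ring
  have e2 : ∫ x, (k - g) x * l x ∂volI
      = (∫ x, (k + f) x * l x ∂volI) - ∫ x, (g + f) x * l x ∂volI := by
    rw [← integral_sub ((hk.add hf).integrable_mul hl) ((hg.add hf).integrable_mul hl)]
    congr 1; ext x; simp; ring
  rw [energyForm, e1, e2, redDeriv, redDeriv]; ring

theorem redDeriv_neg_right (g l : ℝ → ℝ) : redDeriv β yd f g (-l) = -redDeriv β yd f g l := by
  have h : ∀ x, dirSol (-l) x = -dirSol l x := fun x => by
    rw [← neg_one_smul ℝ l, dirSol_const_smul]; ring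
  simp only [redDeriv, h, Pi.neg_apply, mul_neg, integral_neg]; ring

/-- Adding the variational inequalities of the two minimizers leaves a nonpositive energy of their
difference. -/
theorem IsRedMin.ae_eq {g k : ℝ → ℝ} (hP : IsClosedConvexL2 P) (hβ : 0 < β)
    (hyd : MemL2 yd) (hf : MemL2 f) (hg : IsRedMin β yd f P g) (hk : IsRedMin β yd f P k) :
    k =ᵐ[volI] g := by
  have h1 := hg.redDeriv_nonneg hP hyd hf hk.1 hk.2.1
  have h2 := hk.redDeriv_nonneg hP hyd hf hg.1 hg.2.1
  rw [← neg_sub k g, redDeriv_neg_right] at h2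
  have h3 := redDeriv_sub_redDeriv (β := β) hyd hf hg.1 hk.1 (hk.1.sub hg.1)
  have h4 : energyForm β (k - g) (k - g) ≤ 0 := by linarith
  rw [energyForm_self, normL2_sq (k - g)] at h4
  have h5 : ∫ x, (k - g) x ^ 2 ∂volI = 0 := by
    refine le_antisymm ?_ (integral_nonneg fun _ => sq_nonneg _)
    by_contra! h
    have := mul_pos hβ h
    nlinarith [sq_nonneg (normL2 (dirSol (k - g)))]
  rw [integral_eq_zero_iff_of_nonneg (fun _ => sq_nonneg _) (hk.1.sub hg.1).integrable_sq] at h5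
  filter_upwards [h5] with x hx
  simpa [sub_eq_zero] using hx

/-- The basic estimate for the discrete error. -/
theorem energyForm_le_of_isRedMin {Q : (ℝ → ℝ) → Prop} {g gh z : ℝ → ℝ}
    (hQ : IsClosedConvexL2 Q) (hyd : MemL2 yd) (hf : MemL2 f) (hg : MemL2 g)
    (hgh : IsRedMin β yd f Q gh) (hz : MemL2 z) (hQz : Q z) :
    energyForm β (z - gh) (z - gh) ≤
      energyForm β (z - g) (z - gh) + redDeriv β yd f g (z - gh) := by
  -- The energy of `z - gh` is the derivative at `z` minus the derivative at `gh`, in direction `z -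
  -- gh`. The latter is nonnegative, and the former differs from the derivative at `g` by the energy
  -- form of `z - g`.
  have h1 := hgh.redDeriv_nonneg hQ hyd hf hz hQz
  have h2 := redDeriv_sub_redDeriv (β := β) hyd hf hg hz (hz.sub hgh.1)
  have h3 := redDeriv_sub_redDeriv (β := β) hyd hf hgh.1 hz (hz.sub hgh.1)
  linarith

theorem abs_integral_mul_le {a b : ℝ → ℝ} (ha : MemL2 a) (hb : MemL2 b) :
    |∫ x, a x * b x ∂volI| ≤ normL2 a * normL2 b := by
  rw [← ha.inner_toLp hb, ← ha.norm_toLp, ← hb.norm_toLp]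
  exact abs_real_inner_le_norm _ _

theorem energyForm_le (hβ : 0 < β) {k l : ℝ → ℝ} (hk : MemL2 k) (hl : MemL2 l) :
    energyForm β k l ≤ (48 * 48 + β) * (normL2 k * normL2 l) := by
  have h1 := (le_abs_self _).trans (abs_integral_mul_le hk.memL2_dirSol hl.memL2_dirSol)
  have h2 := (le_abs_self _).trans (abs_integral_mul_le hk hl)
  have h3 : normL2 (dirSol k) * normL2 (dirSol l) ≤ (48 * normL2 k) * (48 * normL2 l) :=
    mul_le_mul (normL2_dirSol_le hk) (normL2_dirSol_le hl) (normL2_nonneg _)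
      (by have := normL2_nonneg k; positivity)
  have h4 := mul_le_mul_of_nonneg_left h2 hβ.le
  rw [energyForm]
  linarith

theorem normL2_add_le {a b : ℝ → ℝ} (ha : MemL2 a) (hb : MemL2 b) :
    normL2 (a + b) ≤ normL2 a + normL2 b := by
  rw [← ha.norm_toLp, ← hb.norm_toLp, ← (ha.add hb).norm_toLp, ha.toLp_add hb]
  exact norm_add_le _ _

end

theorem sum_fin_sub_telescope {n : ℕ} (a : Fin (n + 1) → ℝ) :
    ∑ i : Fin n, (a i.succ - a i.castSucc) = a (Fin.last n) - a 0 := by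
  induction n with
  | zero => simp
  | succ n ih =>
    rw [Fin.sum_univ_castSucc]
    have := ih (fun j => a j.castSucc)
    simp only [Fin.succ_castSucc, Fin.castSucc_zero] at this ⊢
    rw [this, Fin.succ_last]; ring

namespace Mesh

variable (M : Mesh)

/-! ### Partitions -/

theorem node_mem (j : Fin (M.n + 1)) : M.node j ∈ Icc (-1 : ℝ) 1 :=
  ⟨by rw [← M.node_zero]; exact M.strictMono.monotone (Fin.zero_le j),
    by rw [← M.node_last]; exact M.strictMono.monotone (Fin.le_last j)⟩

theorem node_lt (i : Fin M.n) : M.node i.castSucc < M.node i.succ :=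
  M.strictMono Fin.castSucc_lt_succ

theorem len_pos (i : Fin M.n) : 0 < M.len i := sub_pos.2 (M.node_lt i)

theorem len_le_h (i : Fin M.n) : M.len i ≤ M.h := le_ciSup (Set.finite_range M.len).bddAbove i

theorem exists_mem_Ioc {x : ℝ} (hx : x ∈ Ioc (-1 : ℝ) 1) :
    ∃ i : Fin M.n, x ∈ Ioc (M.node i.castSucc) (M.node i.succ) := by
  have key : ∀ j : Fin (M.n + 1), x ≤ M.node j →
      ∃ i : Fin M.n, x ∈ Ioc (M.node i.castSucc) (M.node i.succ) := by
    intro j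
    induction j using Fin.induction with
    | zero => intro h; rw [M.node_zero] at h; exact absurd hx.1 (not_lt.2 h)
    | succ i ih =>
      intro h
      rcases le_or_gt x (M.node i.castSucc) with h' | h'
      · exact ih h'
      · exact ⟨i, h', h⟩
  exact key (Fin.last _) (by rw [M.node_last]; exact hx.2)

theorem exists_fin : Nonempty (Fin M.n) := by
  obtain ⟨i, -⟩ := M.exists_mem_Ioc (x := 1) (by norm_num)
  exact ⟨i⟩

theorem exists_mem_cell {x : ℝ} (hx : x ∈ Icc (-1 : ℝ) 1) : ∃ i, x ∈ M.cell i := by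
  rcases hx.1.eq_or_lt with h | h
  · obtain ⟨i⟩ := M.exists_fin
    have hn : 0 < M.n := i.pos
    refine ⟨⟨0, hn⟩, ?_⟩
    have h0 : M.node (Fin.castSucc ⟨0, hn⟩) = -1 := M.node_zero
    have := M.node_lt ⟨0, hn⟩
    exact ⟨by rw [h0]; exact hx.1, by rw [← h, ← h0]; exact this.le⟩
  · obtain ⟨i, hi⟩ := M.exists_mem_Ioc ⟨h, hx.2⟩
    exact ⟨i, hi.1.le, hi.2⟩

theorem h_pos : 0 < M.h := by
  obtain ⟨i⟩ := M.exists_fin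
  exact (M.len_pos i).trans_le (M.len_le_h i)

theorem h_le_two : M.h ≤ 2 := by
  have := M.exists_fin
  refine ciSup_le fun i => ?_
  have h1 := (M.node_mem i.castSucc).1
  have h2 := (M.node_mem i.succ).2
  rw [len]; linarith

theorem eq_of_mem_Ioc {x : ℝ} {i j : Fin M.n} (hi : x ∈ Ioc (M.node i.castSucc) (M.node i.succ))
    (hj : x ∈ Ioc (M.node j.castSucc) (M.node j.succ)) : i = j := by
  have h1 : i.castSucc < j.succ := M.strictMono.lt_iff_lt.1 (hi.1.trans_le hj.2)
  have h2 : j.castSucc < i.succ := M.strictMono.lt_iff_lt.1 (hj.1.trans_le hi.2)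
  rw [Fin.castSucc_lt_succ_iff] at h1 h2
  exact le_antisymm h1 h2

theorem cell_subset (i : Fin M.n) : M.cell i ⊆ Icc (-1) 1 :=
  Icc_subset_Icc (M.node_mem _).1 (M.node_mem _).2

theorem sum_integral_cell {F : ℝ → ℝ} (hF : IntervalIntegrable F volume (-1) 1) :
    ∑ i : Fin M.n, ∫ x in M.node i.castSucc..M.node i.succ, F x = ∫ x, F x ∂volI := by
  have : ∀ i : Fin M.n, ∫ x in M.node i.castSucc..M.node i.succ, F x
      = prim F (M.node i.succ) - prim F (M.node i.castSucc) := fun i =>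
    (prim_sub_prim hF (M.node_mem _) (M.node_mem _)).symm
  simp_rw [this]
  rw [sum_fin_sub_telescope (fun j => prim F (M.node j)), M.node_zero, M.node_last, prim_left,
    sub_zero, integral_volI]; rfl

/-! ### Nodal interpolation -/

theorem nodalP1_node (g : ℝ → ℝ) (j : Fin (M.n + 1)) : M.nodalP1 g (M.node j) = g (M.node j) := by
  have hx : ∃ i, M.node j ∈ M.cell i := M.exists_mem_cell (M.node_mem j)
  rw [nodalP1, dif_pos hx]
  set i := hx.choose
  have hi : M.node j ∈ M.cell i := hx.choose_spec
  have h1 : i.castSucc ≤ j := M.strictMono.le_iff_le.1 hi.1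
  have h2 : j ≤ i.succ := M.strictMono.le_iff_le.1 hi.2
  have hne := (M.len_pos i).ne'
  rcases h1.eq_or_lt with h | h
  · simp [← h]
  · have : j = i.succ := le_antisymm h2 (Fin.castSucc_lt_iff_succ_le.1 h)
    rw [this, show M.node i.succ - M.node i.castSucc = M.len i from rfl, div_self hne]
    ring

theorem nodalP1_le {g g' : ℝ → ℝ} (h : ∀ j, g (M.node j) ≤ g' (M.node j)) {x : ℝ}
    (hx : x ∈ Icc (-1 : ℝ) 1) : M.nodalP1 g x ≤ M.nodalP1 g' x := by
  have hx : ∃ i, x ∈ M.cell i := M.exists_mem_cell hx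
  rw [nodalP1, nodalP1, dif_pos hx, dif_pos hx]
  set i := hx.choose
  have hi : x ∈ M.cell i := hx.choose_spec
  have hpos := M.len_pos i
  have h0 : 0 ≤ (x - M.node i.castSucc) / M.len i := div_nonneg (sub_nonneg.2 hi.1) hpos.le
  have h1 : (x - M.node i.castSucc) / M.len i ≤ 1 := by
    rw [div_le_one hpos, len]; linarith [hi.2]
  nlinarith [h i.castSucc, h i.succ]

theorem memKh_iff {ψ v : ℝ → ℝ} : M.MemKh ψ v ↔ M.MemVh v ∧
    ∀ j, derivWithin v (Icc (-1) 1) (M.node j) ≤ ψ (M.node j) := by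
  refine and_congr_right fun _ => ⟨fun h j => ?_, fun h x hx => M.nodalP1_le h hx⟩
  have := h _ (M.node_mem j)
  rwa [nodalP1_node, nodalP1_node] at this

/-! ### Piecewise affine functions -/

/-- The piecewise affine function that is `a i + b i * x` on the `i`-th cell. -/
noncomputable def pwAffine (a b : Fin M.n → ℝ) (x : ℝ) : ℝ :=
  ∑ i, (Ioc (M.node i.castSucc) (M.node i.succ)).indicator (fun t => a i + b i * t) x

theorem pwAffine_apply (a b : Fin M.n → ℝ) {i : Fin M.n} {x : ℝ}
    (hx : x ∈ Ioc (M.node i.castSucc) (M.node i.succ)) : M.pwAffine a b x = a i + b i * x := by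
  rw [pwAffine, Finset.sum_eq_single i]
  · rw [indicator_of_mem hx]
  · intro j _ hj
    exact indicator_of_notMem (fun h => hj (M.eq_of_mem_Ioc h hx)) _
  · simp

theorem memL2_pwAffine (a b : Fin M.n → ℝ) : MemL2 (M.pwAffine a b) := by
  have : M.pwAffine a b = fun x => ∑ i, (Ioc (M.node i.castSucc) (M.node i.succ)).indicator
    (fun t => a i + b i * t) x := rfl
  rw [this]
  refine memLp_finsetSum _ fun i _ => MemLp.indicator measurableSet_Ioc ?_
  exact memL2_of_continuousOn (by fun_prop)

/-- `k` is almost everywhere equal to a piecewise affine function. -/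
def IsPwAffine (k : ℝ → ℝ) : Prop := ∃ a b, k =ᵐ[volI] M.pwAffine a b

variable {M}

theorem IsPwAffine.memL2 {k : ℝ → ℝ} (hk : M.IsPwAffine k) : MemL2 k := by
  obtain ⟨a, b, h⟩ := hk
  exact (M.memL2_pwAffine a b).congr h.symm

theorem pwAffine_add (a b a' b' : Fin M.n → ℝ) :
    M.pwAffine (a + a') (b + b') = M.pwAffine a b + M.pwAffine a' b' := by
  ext x
  simp only [pwAffine, Pi.add_apply, ← Finset.sum_add_distrib]
  refine Finset.sum_congr rfl fun i _ => ?_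
  simp only [indicator]
  split_ifs <;> ring

theorem pwAffine_smul (c : ℝ) (a b : Fin M.n → ℝ) :
    M.pwAffine (c • a) (c • b) = c • M.pwAffine a b := by
  ext x
  simp only [pwAffine, Pi.smul_apply, smul_eq_mul, Finset.mul_sum]
  refine Finset.sum_congr rfl fun i _ => ?_
  simp only [indicator]
  split_ifs <;> ring

variable (M) in
/-- The space of piecewise affine functions as a subspace of `L₂(I)`. -/
noncomputable def pwAffineL2 : Submodule ℝ (Lp ℝ 2 volI) :=
  LinearMap.range
    ({ toFun := fun p => (M.memL2_pwAffine p.1 p.2).toLp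
       map_add' := fun p q => by
        rw [← MemL2.toLp_add]
        exact MemL2.toLp_congr _ _ (by rw [Prod.fst_add, Prod.snd_add, pwAffine_add])
       map_smul' := fun c p => by
        rw [RingHom.id_apply, ← MemL2.toLp_const_smul]
        exact MemL2.toLp_congr _ _ (by rw [Prod.smul_fst, Prod.smul_snd, pwAffine_smul]) } :
      (Fin M.n → ℝ) × (Fin M.n → ℝ) →ₗ[ℝ] Lp ℝ 2 volI)

instance : FiniteDimensional ℝ M.pwAffineL2 := LinearMap.finiteDimensional_range _

theorem mem_pwAffineL2_iff {g : Lp ℝ 2 volI} : g ∈ M.pwAffineL2 ↔ M.IsPwAffine g := by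
  rw [pwAffineL2, LinearMap.mem_range]
  constructor
  · rintro ⟨p, rfl⟩
    exact ⟨p.1, p.2, (M.memL2_pwAffine p.1 p.2).coeFn_toLp⟩
  · rintro ⟨a, b, h⟩
    refine ⟨(a, b), ?_⟩
    rw [← toLp_coe g]
    exact (M.memL2_pwAffine a b).toLp_congr (memL2_coe g) h.symm

theorem isPwAffine_toLp {k : ℝ → ℝ} (hk : MemL2 k) : M.IsPwAffine hk.toLp ↔ M.IsPwAffine k :=
  ⟨fun ⟨a, b, h⟩ => ⟨a, b, hk.coeFn_toLp.symm.trans h⟩,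
    fun ⟨a, b, h⟩ => ⟨a, b, hk.coeFn_toLp.trans h⟩⟩

theorem IsPwAffine.add_smul_sub {k l : ℝ → ℝ} (hk : M.IsPwAffine k) (hl : M.IsPwAffine l) (t : ℝ) :
    M.IsPwAffine (k + t • (l - k)) := by
  obtain ⟨a, b, h⟩ := hk
  obtain ⟨a', b', h'⟩ := hl
  refine ⟨a + t • (a' + (-1 : ℝ) • a), b + t • (b' + (-1 : ℝ) • b), ?_⟩
  rw [pwAffine_add, pwAffine_smul, pwAffine_add, pwAffine_smul]
  filter_upwards [h, h'] with x hx hx'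
  simp [hx, hx']; ring

/-- Orthogonality to cell indicators makes `prim e` vanish at every node. Orthogonality to `1 - x`
then removes the mean of `prim e`. This is why affine pieces are needed: piecewise constants would
not control the mean. -/
theorem integral_eq_zero_of_orthogonal {e : ℝ → ℝ} (he : MemL2 e)
    (h : ∀ a b, ∫ x, e x * M.pwAffine a b x ∂volI = 0) (j : Fin (M.n + 1)) :
    mzPrim e (M.node j) = 0 := by
  have hcell : ∀ i : Fin M.n, ∫ x in M.node i.castSucc..M.node i.succ, e x = 0 := fun i => by
    rw [← h (Pi.single i 1) 0, integral_volI, intervalIntegral.integral_of_le (M.node_lt i).le,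
      intervalIntegral.integral_of_le (by norm_num), ← integral_indicator measurableSet_Ioc,
      ← integral_indicator measurableSet_Ioc]
    congr 1; ext x
    by_cases hx : x ∈ Ioc (-1 : ℝ) 1
    · obtain ⟨j, hj⟩ := M.exists_mem_Ioc hx
      rw [indicator_of_mem hx, M.pwAffine_apply _ _ hj]
      by_cases hij : j = i
      · subst hij
        rw [indicator_of_mem hj]; simp
      · rw [indicator_of_notMem fun hi => hij (M.eq_of_mem_Ioc hj hi)]; simp [hij]
    · rw [indicator_of_notMem hx, indicator_of_notMem]
      exact fun hi => hx ⟨(M.node_mem _).1.trans_lt hi.1, hi.2.trans (M.node_mem _).2⟩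
  have hprim : ∀ j, prim e (M.node j) = 0 := by
    intro j
    induction j using Fin.induction with
    | zero => rw [M.node_zero, prim_left]
    | succ i ih =>
      have := prim_sub_prim he.intervalIntegrable (M.node_mem i.castSucc) (M.node_mem i.succ)
      rw [hcell i, ih] at this
      linarith
  have h1 : ∫ x, e x * (1 - x) ∂volI = 0 := by
    rw [← h 1 (-1)]
    apply integral_congr_ae
    filter_upwards [ae_mem_I] with x hx
    obtain ⟨j, hj⟩ := M.exists_mem_Ioc (Ioo_subset_Ioc_self hx)
    rw [M.pwAffine_apply _ _ hj]
    simp only [Pi.one_apply, Pi.neg_apply]; ring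
  have h2 : prim (prim e) 1 = 0 := by
    have := integral_prim_mul_prim (k := fun _ => 1) (l := e) (by simp) he.intervalIntegrable
    have h0 : prim e 1 = 0 := by rw [← M.node_last]; exact hprim _
    have hp : ∀ x, prim (fun _ => 1) x = x + 1 := fun x => by simp [prim]
    simp only [mul_one, hp, h0, zero_mul, zero_sub] at this
    rw [prim, this]
    rw [integral_volI] at h1
    have hs : (∫ x in (-1 : ℝ)..1, e x * (x + 1)) + ∫ x in (-1 : ℝ)..1, e x * (1 - x)
        = 2 * ∫ x in (-1 : ℝ)..1, e x := by
      rw [← intervalIntegral.integral_add, ← intervalIntegral.integral_const_mul]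
      · congr 1; ext x; ring
      · exact he.intervalIntegrable.mul_continuousOn (by fun_prop)
      · exact he.intervalIntegrable.mul_continuousOn (by fun_prop)
    have h0' : ∫ x in (-1 : ℝ)..1, e x = 0 := h0
    rw [h1, h0'] at hs
    linarith
  rw [mzPrim, hprim, h2]; ring

/-- The `L₂` projection onto piecewise affine functions preserves the nodal values of `mzPrim`. -/
theorem exists_isPwAffine_projection (M : Mesh) {g : ℝ → ℝ} (hg : MemL2 g) :
    ∃ z, M.IsPwAffine z ∧ (∀ j, mzPrim z (M.node j) = mzPrim g (M.node j)) ∧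
      ∀ p, M.IsPwAffine p → normL2 (z - g) ≤ normL2 (p - g) := by
  set z : Lp ℝ 2 volI := M.pwAffineL2.starProjection hg.toLp
  have hz : M.IsPwAffine z := mem_pwAffineL2_iff.1 (Submodule.starProjection_apply_mem _ _)
  refine ⟨z, hz, fun j => ?_, fun p hp => ?_⟩
  · have := integral_eq_zero_of_orthogonal (M := M) (hg.sub (memL2_coe z)) (fun a b => ?_) j
    · rw [mzPrim_sub hg (memL2_coe z) (M.node_mem j)] at this
      linarith
    · rw [← (hg.sub (memL2_coe z)).inner_toLp (M.memL2_pwAffine a b),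
        hg.toLp_sub (memL2_coe z), toLp_coe]
      exact Submodule.starProjection_inner_eq_zero _ _
        (mem_pwAffineL2_iff.2 ((isPwAffine_toLp _).2 ⟨a, b, ae_eq_refl _⟩))
  · rw [← ((memL2_coe z).sub hg).norm_toLp, ← (hp.memL2.sub hg).norm_toLp,
      (memL2_coe z).toLp_sub hg, hp.memL2.toLp_sub hg, toLp_coe, norm_sub_rev, norm_sub_rev _ hg.toLp,
      Submodule.starProjection_minimal]
    exact ciInf_le ⟨0, by rintro _ ⟨_, rfl⟩; positivity⟩
      (⟨hp.memL2.toLp, mem_pwAffineL2_iff.2 ((isPwAffine_toLp _).2 hp)⟩ : M.pwAffineL2)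

end Mesh

/-! ### The cubic Hermite space -/

theorem hasDerivWithinAt_prim {F : ℝ → ℝ} (hF : ContinuousOn F (Icc (-1) 1)) {x : ℝ}
    (hx : x ∈ Icc (-1 : ℝ) 1) : HasDerivWithinAt (prim F) (F x) (Icc (-1) 1) x := by
  -- Freezing `F` at its end values gives a continuous function on the line, so the two-sided
  -- fundamental theorem also covers the points `±1`.
  let G : ℝ → ℝ := fun t => F (max (-1) (min 1 t))
  have hG : Continuous G := by
    refine hF.comp_continuous (by fun_prop) fun t => ⟨le_max_left _ _, ?_⟩
    exact max_le (by norm_num) (min_le_left _ _)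
  have hFG : EqOn F G (Icc (-1) 1) := fun t ht => by
    simp only [G]
    rw [min_eq_right ht.2, max_eq_right ht.1]
  have h : HasDerivAt (prim G) (G x) x := (hG.integral_hasStrictDerivAt _ x).hasDerivAt
  rw [hFG hx]
  exact h.hasDerivWithinAt.congr (fun t ht => prim_eqOn hFG ht) (prim_eqOn hFG hx)

theorem uniqueDiffOn_Icc_neg_one_one : UniqueDiffOn ℝ (Icc (-1 : ℝ) 1) :=
  uniqueDiffOn_Icc (by norm_num)

theorem hasDerivWithinAt_dirSol {k v : ℝ → ℝ} (hk : MemL2 k) (h : EqOn v (dirSol k) (Icc (-1) 1))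
    {x : ℝ} (hx : x ∈ Icc (-1 : ℝ) 1) : HasDerivWithinAt v (mzPrim k x) (Icc (-1) 1) x :=
  (hasDerivWithinAt_prim hk.continuousOn_mzPrim hx).congr h (h hx)

theorem derivWithin_dirSol {k v : ℝ → ℝ} (hk : MemL2 k) (h : EqOn v (dirSol k) (Icc (-1) 1))
    {x : ℝ} (hx : x ∈ Icc (-1 : ℝ) 1) : derivWithin v (Icc (-1) 1) x = mzPrim k x :=
  (hasDerivWithinAt_dirSol hk h hx).derivWithin (uniqueDiffOn_Icc_neg_one_one x hx)

theorem contDiffOn_dirSol {k v : ℝ → ℝ} (hk : MemL2 k) (h : EqOn v (dirSol k) (Icc (-1) 1)) :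
    ContDiffOn ℝ 1 v (Icc (-1) 1) :=
  (contDiffOn_one_iff_derivWithin uniqueDiffOn_Icc_neg_one_one).2
    ⟨fun _ hx => (hasDerivWithinAt_dirSol hk h hx).differentiableWithinAt,
      hk.continuousOn_mzPrim.congr fun _ hx => derivWithin_dirSol hk h hx⟩

theorem mzPrim_sub_mzPrim {k : ℝ → ℝ} (hk : MemL2 k) {x y : ℝ} (hx : x ∈ Icc (-1 : ℝ) 1)
    (hy : y ∈ Icc (-1 : ℝ) 1) : mzPrim k y - mzPrim k x = ∫ t in x..y, k t := by
  rw [← prim_sub_prim hk.intervalIntegrable hx hy, mzPrim, mzPrim]; ring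

theorem dirSol_sub_dirSol {k : ℝ → ℝ} (hk : MemL2 k) {x y : ℝ} (hx : x ∈ Icc (-1 : ℝ) 1)
    (hy : y ∈ Icc (-1 : ℝ) 1) : dirSol k y - dirSol k x = ∫ t in x..y, mzPrim k t :=
  prim_sub_prim hk.memL2_mzPrim.intervalIntegrable hx hy

namespace Mesh

variable {M : Mesh}

theorem IsPwAffine.memVh {k v : ℝ → ℝ} (hk : M.IsPwAffine k)
    (h : EqOn v (dirSol k) (Icc (-1) 1)) : M.MemVh v := by
  have hk2 := hk.memL2
  refine ⟨contDiffOn_dirSol hk2 h, by rw [h left_mem, dirSol_left],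
    by rw [h right_mem, hk2.dirSol_right], fun i => ?_⟩
  obtain ⟨a, b, hab⟩ := hk
  set s := M.node i.castSucc with hs
  set e := M.node i.succ
  have hse : s < e := M.node_lt i
  have hsI : s ∈ Icc (-1 : ℝ) 1 := M.node_mem _
  have hmz : ∀ x ∈ M.cell i, mzPrim k x =
      mzPrim k s + a i * (x - s) + b i * (x ^ 2 - s ^ 2) / 2 := fun x hx => by
    have hxI := M.cell_subset i hx
    have h1 := mzPrim_sub_mzPrim hk2 hsI hxI
    have h2 : ∫ t in s..x, k t = ∫ t in s..x, (a i + b i * t) := by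
      apply intervalIntegral.integral_congr_ae
      have h1 : ∀ᵐ t : ℝ, t ≠ 1 := by simp [ae_iff, measure_singleton]
      filter_upwards [ae_volI_iff.1 hab, h1] with t ht ht1 hts
      rw [uIoc_of_le hx.1] at hts
      rw [ht ⟨hsI.1.trans_lt hts.1, lt_of_le_of_ne (hts.2.trans hxI.2) ht1⟩,
        M.pwAffine_apply a b (i := i) ⟨hts.1, hts.2.trans hx.2⟩]
    have h3 : ∫ t in s..x, (a i + b i * t) = a i * (x - s) + b i * (x ^ 2 - s ^ 2) / 2 := by
      rw [intervalIntegral.integral_add (by simp) ((by fun_prop : Continuous fun t => b i * t)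
        |>.intervalIntegrable _ _), intervalIntegral.integral_const_mul, integral_id]
      simp; ring
    linarith
  -- The affine function `a + b x` integrated twice from `s`. The last term is the primitive of `b
  -- (t² - s²) / 2` in factored form.
  refine ⟨C (dirSol k s) + C (mzPrim k s) * (X - C s) + C (a i / 2) * (X - C s) ^ 2
    + C (b i / 6) * (X - C s) ^ 2 * (X + C (2 * s)), by compute_degree, fun x hx => ?_⟩
  have hxI := M.cell_subset i hx
  have h1 := dirSol_sub_dirSol hk2 hsI hxI
  have h2 : ∫ t in s..x, mzPrim k t
      = ∫ t in s..x, (mzPrim k s + a i * (t - s) + b i * (t ^ 2 - s ^ 2) / 2) := by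
    apply intervalIntegral.integral_congr
    intro t ht
    rw [uIcc_of_le hx.1] at ht
    exact hmz t ⟨ht.1, ht.2.trans hx.2⟩
  have h3 : ∫ t in s..x, (mzPrim k s + a i * (t - s) + b i * (t ^ 2 - s ^ 2) / 2)
      = mzPrim k s * (x - s) + a i / 2 * (x - s) ^ 2 + b i / 6 * (x - s) ^ 2 * (x + 2 * s) := by
    rw [intervalIntegral.integral_eq_sub_of_hasDerivAt (f := fun t => mzPrim k s * (t - s)
      + a i / 2 * (t - s) ^ 2 + b i / 6 * (t - s) ^ 2 * (t + 2 * s))]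
    · ring
    · intro t _
      have h0 : HasDerivAt (fun t => t - s) 1 t := (hasDerivAt_id t).sub_const s
      have h0' : HasDerivAt (fun t => t + 2 * s) 1 t := (hasDerivAt_id t).add_const _
      refine (((h0.const_mul (mzPrim k s)).add ((h0.pow 2).const_mul (a i / 2))).add
        (((h0.pow 2).const_mul (b i / 6)).mul h0')).congr_deriv ?_
      simp; ring
    · exact (by fun_prop : Continuous fun t => mzPrim k s + a i * (t - s)
        + b i * (t ^ 2 - s ^ 2) / 2).intervalIntegrable _ _
  rw [h hxI]
  simp only [eval_add, eval_mul, eval_C, eval_sub, eval_X, eval_pow]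
  linarith

/-- The derivative of `v` is continuous and, off the finitely many nodes, differentiable with affine
derivative on each cell. The fundamental theorem with countably many exceptions therefore rules out
jumps: `v` lies in `V` and its second weak derivative is the piecewise affine function. -/
theorem MemVh.exists_isPwAffine {v : ℝ → ℝ} (hv : M.MemVh v) :
    ∃ k, M.IsPwAffine k ∧ EqOn v (dirSol k) (Icc (-1) 1) := by
  obtain ⟨hc, h0, h1, hp⟩ := hv
  choose p hdeg hpv using hp
  set d := derivWithin v (Icc (-1) 1)
  have hd : ContinuousOn d (Icc (-1) 1) :=
    hc.continuousOn_derivWithin uniqueDiffOn_Icc_neg_one_one le_rfl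
  have haff : ∀ i, ∃ b a : ℝ, ∀ x, (derivative (derivative (p i))).eval x = a + b * x := fun i => by
    obtain ⟨b, a, hab⟩ := exists_eq_X_add_C_of_natDegree_le_one
      (p := derivative (derivative (p i))) (by
        have h1 := natDegree_derivative_le (p i)
        have h2 := natDegree_derivative_le (derivative (p i))
        have := hdeg i
        omega)
    refine ⟨b, a, fun x => ?_⟩
    rw [hab]; simp; ring
  choose b a hab using haff
  have hnhds : ∀ {i x}, x ∈ Ioo (M.node i.castSucc) (M.node i.succ) → M.cell i ∈ nhds x :=
    fun hx => Icc_mem_nhds hx.1 hx.2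
  have hvd : ∀ x ∈ Icc (-1 : ℝ) 1, HasDerivWithinAt v (d x) (Icc (-1) 1) x := fun x hx =>
    (hc.differentiableOn one_ne_zero x hx).hasDerivWithinAt
  have hdp : ∀ i, ∀ x ∈ Ioo (M.node i.castSucc) (M.node i.succ),
      d x = (derivative (p i)).eval x := fun i x hx => by
    have hI := M.cell_subset i (Ioo_subset_Icc_self hx)
    have e1 : HasDerivAt v (d x) x := (hvd x hI).hasDerivAt
      (Filter.mem_of_superset (hnhds hx) (M.cell_subset i))
    have e2 : HasDerivAt v ((derivative (p i)).eval x) x := ((p i).hasDerivAt x).congr_of_eventuallyEq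
      (Filter.mem_of_superset (hnhds hx) (hpv i))
    exact e1.unique e2
  have hdd : ∀ i : Fin M.n, ∀ x ∈ Ioo (M.node i.castSucc) (M.node i.succ),
      HasDerivAt d (M.pwAffine a b x) x := fun i x hx => by
    rw [M.pwAffine_apply a b (Ioo_subset_Ioc_self hx), ← hab]
    exact ((derivative (p i)).hasDerivAt x).congr_of_eventuallyEq
      (Filter.mem_of_superset (Ioo_mem_nhds hx.1 hx.2) (hdp i))
  have hk2 := M.memL2_pwAffine a b
  have hdprim : ∀ x ∈ Icc (-1 : ℝ) 1, d x = d (-1) + prim (M.pwAffine a b) x := fun x hx => by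
    have := integral_eq_of_hasDerivAt_off_countable_of_le d (M.pwAffine a b) hx.1
      (s := range M.node) (Set.finite_range _).countable (hd.mono (Icc_subset_Icc_right hx.2))
      (fun t ht => by
        obtain ⟨i, hi⟩ := M.exists_mem_Ioc (x := t) ⟨ht.1.1, ht.1.2.le.trans hx.2⟩
        exact hdd i t ⟨hi.1, lt_of_le_of_ne hi.2 fun h => ht.2 ⟨_, h.symm⟩⟩)
      (hk2.intervalIntegrable' left_mem hx)
    rw [prim, this]; ring
  have hvprim : ∀ x ∈ Icc (-1 : ℝ) 1, v x = 0 + prim d x := fun x hx => by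
    have := intervalIntegral.integral_eq_sub_of_hasDerivAt_of_le hx.1
      (hc.continuousOn.mono (Icc_subset_Icc_right hx.2))
      (fun t ht => (hvd t ⟨ht.1.le, ht.2.le.trans hx.2⟩).hasDerivAt
        (Icc_mem_nhds ht.1 (ht.2.trans_le hx.2)))
      ((memL2_of_continuousOn hd).intervalIntegrable' left_mem hx)
    rw [prim, this, h0]; ring
  have w1 : IsWeakDeriv v d := isWeakDeriv_prim (memL2_of_continuousOn hd).integrable 0 (by
    filter_upwards [ae_mem_I] with x hx using hvprim x (Ioo_subset_Icc_self hx))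
  have w2 : IsWeakDeriv d (M.pwAffine a b) := isWeakDeriv_prim hk2.integrable (d (-1)) (by
    filter_upwards [ae_mem_I] with x hx using hdprim x (Ioo_subset_Icc_self hx))
  obtain ⟨k, hk, hvk⟩ := memV_iff.1 (⟨memSobolev_two_iff.2 ⟨memL2_of_continuousOn hc.continuousOn,
    d, w1, memL2_of_continuousOn hd, _, w2, hk2⟩, hc.continuousOn, h0, h1⟩ : MemV v)
  refine ⟨k, ⟨a, b, ?_⟩, hvk⟩
  have e1 : d =ᵐ[volI] mzPrim k := w1.ae_eq (isWeakDeriv_of_eqOn_dirSol hk hvk)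
  exact (isWeakDeriv_of_ae_eq_mzPrim hk e1).ae_eq w2

/-- The constraint of the discrete problem in terms of `y''`. -/
def DiscreteConstraint (M : Mesh) (ψ k : ℝ → ℝ) : Prop :=
  M.IsPwAffine k ∧ ∀ j, mzPrim k (M.node j) ≤ ψ (M.node j)

theorem memKh_iff_exists {ψ v : ℝ → ℝ} :
    M.MemKh ψ v ↔ ∃ k, M.DiscreteConstraint ψ k ∧ EqOn v (dirSol k) (Icc (-1) 1) := by
  rw [memKh_iff]
  constructor
  · rintro ⟨hv, hj⟩
    obtain ⟨k, hk, hvk⟩ := hv.exists_isPwAffine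
    refine ⟨k, ⟨hk, fun j => ?_⟩, hvk⟩
    rw [← derivWithin_dirSol hk.memL2 hvk (M.node_mem j)]
    exact hj j
  · rintro ⟨k, ⟨hk, hj⟩, hvk⟩
    refine ⟨hk.memVh hvk, fun j => ?_⟩
    rw [derivWithin_dirSol hk.memL2 hvk (M.node_mem j)]
    exact hj j

end Mesh

/-! ### Both problems as minimization over second derivatives -/

theorem cost_dirSol {β : ℝ} {yd f y k : ℝ → ℝ} (hk : MemL2 k)
    (h : EqOn y (dirSol k) (Icc (-1) 1)) :
    cost β yd y (weakDeriv^[2] y + f) = 1 / 2 * redCost β yd f k := by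
  have h1 : normL2 (y - yd) = normL2 (dirSol k - yd) :=
    normL2_congr_Icc fun x hx => by simp [h hx]
  have h2 : normL2 (weakDeriv^[2] y + f) = normL2 (k + f) := normL2_congr (by
    filter_upwards [weakDeriv_two_dirSol hk h] with x hx
    rw [Pi.add_apply, Pi.add_apply, hx])
  rw [cost, redCost, h1, h2]

theorem Mesh.isDiscreteSolution_iff {M : Mesh} {β : ℝ} {yd f ψ y : ℝ → ℝ} :
    M.IsDiscreteSolution β yd f ψ y ↔
      ∃ k, IsRedMin β yd f (M.DiscreteConstraint ψ) k ∧ EqOn y (dirSol k) (Icc (-1) 1) := by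
  constructor
  · rintro ⟨hy, hmin⟩
    obtain ⟨k, hk, hyk⟩ := memKh_iff_exists.1 hy
    refine ⟨k, ⟨hk.1.memL2, hk, fun l hl hPl => ?_⟩, hyk⟩
    have := hmin (dirSol l) (memKh_iff_exists.2 ⟨l, hPl, eqOn_refl _ _⟩)
    rw [cost_dirSol hk.1.memL2 hyk, cost_dirSol hl (eqOn_refl _ _)] at this
    linarith
  · rintro ⟨k, ⟨hk, hPk, hmin⟩, hyk⟩
    refine ⟨memKh_iff_exists.2 ⟨k, hPk, hyk⟩, fun z hz => ?_⟩
    obtain ⟨l, hPl, hzl⟩ := memKh_iff_exists.1 hz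
    rw [cost_dirSol hk hyk, cost_dirSol hPl.1.memL2 hzl]
    have := hmin l hPl.1.memL2 hPl
    linarith

/-- The constraint of the continuous problem in terms of `y''`. -/
def Constraint (ψ k : ℝ → ℝ) : Prop := ∀ x ∈ Icc (-1 : ℝ) 1, mzPrim k x ≤ ψ x

/-- Continuity of `mzPrim k` and of `ψ` turns the almost everywhere constraint into one at every
point of the closed interval, in particular at the nodes. -/
theorem admissible_iff {f ψ y u : ℝ → ℝ} (hf : MemL2 f) (hψ : ContinuousOn ψ (Icc (-1) 1)) :
    Admissible f ψ y u ↔ ∃ k, MemL2 k ∧ Constraint ψ k ∧ EqOn y (dirSol k) (Icc (-1) 1) ∧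
      u =ᵐ[volI] -k - f := by
  constructor
  · rintro ⟨hy, hu, hyu, hyψ⟩
    obtain ⟨k, hk, hyk⟩ := memV_iff.1 hy
    refine ⟨k, hk, fun x hx => ?_, hyk, ?_⟩
    · refine le_of_ae_le ?_ hk.continuousOn_mzPrim hψ hx
      filter_upwards [hyψ, weakDeriv_dirSol hk hyk] with x h1 h2
      rwa [← h2]
    · filter_upwards [hyu, weakDeriv_two_dirSol hk hyk] with x h1 h2
      rw [h2] at h1
      simp only [Pi.sub_apply, Pi.neg_apply]; linarith
  · rintro ⟨k, hk, hc, hyk, hu⟩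
    refine ⟨memV_iff.2 ⟨k, hk, hyk⟩, (hk.neg.sub hf).congr hu.symm, ?_, ?_⟩
    · filter_upwards [hu, weakDeriv_two_dirSol hk hyk] with x h1 h2
      rw [h1, h2]; simp
    · filter_upwards [weakDeriv_dirSol hk hyk, ae_mem_I] with x h1 h2
      rw [h1]
      exact hc x (Ioo_subset_Icc_self h2)

theorem cost_eq_of_ae_eq {β : ℝ} {yd f y u k : ℝ → ℝ}
    (h : EqOn y (dirSol k) (Icc (-1) 1)) (hu : u =ᵐ[volI] -k - f) :
    cost β yd y u = 1 / 2 * redCost β yd f k := by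
  have h1 : normL2 (y - yd) = normL2 (dirSol k - yd) :=
    normL2_congr_Icc fun x hx => by simp [h hx]
  have h2 : normL2 u ^ 2 = normL2 (k + f) ^ 2 := by
    rw [normL2_congr hu, normL2_sq, normL2_sq]
    congr 1; ext x; simp; ring
  rw [cost, redCost, h1, h2]

theorem isSolution_iff {β : ℝ} {yd f ψ y u : ℝ → ℝ} (hf : MemL2 f)
    (hψ : ContinuousOn ψ (Icc (-1) 1)) :
    IsSolution β yd f ψ y u ↔ ∃ k, IsRedMin β yd f (Constraint ψ) k ∧
      EqOn y (dirSol k) (Icc (-1) 1) ∧ u =ᵐ[volI] -k - f := by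
  constructor
  · rintro ⟨hy, hmin⟩
    obtain ⟨k, hk, hc, hyk, hu⟩ := (admissible_iff hf hψ).1 hy
    refine ⟨k, ⟨hk, hc, fun l hl hPl => ?_⟩, hyk, hu⟩
    have := hmin (dirSol l) (-l - f)
      ((admissible_iff hf hψ).2 ⟨l, hl, hPl, eqOn_refl _ _, ae_eq_refl _⟩)
    rw [cost_eq_of_ae_eq hyk hu, cost_eq_of_ae_eq (eqOn_refl _ _) (ae_eq_refl _)] at this
    linarith
  · rintro ⟨k, ⟨hk, hc, hmin⟩, hyk, hu⟩
    refine ⟨(admissible_iff hf hψ).2 ⟨k, hk, hc, hyk, hu⟩, fun z w hz => ?_⟩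
    obtain ⟨l, hl, hPl, hzl, hw⟩ := (admissible_iff hf hψ).1 hz
    rw [cost_eq_of_ae_eq hyk hu, cost_eq_of_ae_eq hzl hw]
    have := hmin l hl hPl
    linarith

/-! ### Closedness and convexity of the constraints -/

theorem mzPrim_add_smul_sub {k l : ℝ → ℝ} (hk : MemL2 k) (hl : MemL2 l) (t : ℝ) {x : ℝ}
    (hx : x ∈ Icc (-1 : ℝ) 1) :
    mzPrim (k + t • (l - k)) x = (1 - t) * mzPrim k x + t * mzPrim l x := by
  rw [mzPrim_add hk ((hl.sub hk).const_smul t) hx, mzPrim_const_smul, mzPrim_sub hl hk hx]; ring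

theorem mzPrim_add_smul_sub_le {k l : ℝ → ℝ} (hk : MemL2 k) (hl : MemL2 l) {t : ℝ} (ht0 : 0 ≤ t)
    (ht1 : t ≤ 1) {x c : ℝ} (hx : x ∈ Icc (-1 : ℝ) 1) (hkc : mzPrim k x ≤ c)
    (hlc : mzPrim l x ≤ c) : mzPrim (k + t • (l - k)) x ≤ c := by
  rw [mzPrim_add_smul_sub hk hl t hx]
  nlinarith

/-- An intersection of half-spaces of the bounded functionals `mzPrimCLM`. -/
theorem isClosedConvexL2_constraint {ψ : ℝ → ℝ} (hne : ∃ k, MemL2 k ∧ Constraint ψ k) :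
    IsClosedConvexL2 (Constraint ψ) where
  congr k l h hk x hx := by rw [← mzPrim_congr h hx]; exact hk x hx
  convex k l hk hl hPk hPl t ht0 ht1 x hx :=
    mzPrim_add_smul_sub_le hk hl ht0 ht1 hx (hPk x hx) (hPl x hx)
  closed := by
    have : {g : Lp ℝ 2 volI | Constraint ψ g} =
        ⋂ x : ℝ, ⋂ _ : x ∈ Icc (-1 : ℝ) 1, {g : Lp ℝ 2 volI | mzPrim g x ≤ ψ x} := by
      ext g; simp only [Constraint, mem_ofPred_eq, mem_iInter]
    rw [this]
    exact isClosed_iInter fun x => isClosed_iInter fun hx => isClosed_mzPrim_le hx _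
  nonempty := hne

namespace Mesh

variable {M : Mesh}

theorem isClosedConvexL2_discreteConstraint {ψ : ℝ → ℝ}
    (hne : ∃ k, MemL2 k ∧ M.DiscreteConstraint ψ k) :
    IsClosedConvexL2 (M.DiscreteConstraint ψ) where
  congr k l h hk := by
    obtain ⟨⟨a, b, hab⟩, hj⟩ := hk
    refine ⟨⟨a, b, h.symm.trans hab⟩, fun j => ?_⟩
    rw [← mzPrim_congr h (M.node_mem j)]; exact hj j
  convex k l hk hl hPk hPl t ht0 ht1 := ⟨hPk.1.add_smul_sub hPl.1 t, fun j =>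
    mzPrim_add_smul_sub_le hk hl ht0 ht1 (M.node_mem j) (hPk.2 j) (hPl.2 j)⟩
  closed := by
    have : {g : Lp ℝ 2 volI | M.DiscreteConstraint ψ g} = (M.pwAffineL2 : Set (Lp ℝ 2 volI)) ∩
        ⋂ j, {g : Lp ℝ 2 volI | mzPrim g (M.node j) ≤ ψ (M.node j)} := by
      ext g
      simp only [DiscreteConstraint, mem_ofPred_eq, mem_inter_iff, mem_iInter, SetLike.mem_coe,
        mem_pwAffineL2_iff]
    rw [this]
    exact (Submodule.closed_of_finiteDimensional _).inter
      (isClosed_iInter fun j => isClosed_mzPrim_le (M.node_mem j) _)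
  nonempty := hne

end Mesh

/-! ### The Lagrange multiplier -/

/-- The functional `q ↦ ∫ Θ q - ∫ m q'` at `q = c + prim k`. -/
noncomputable def dualForm (Θ m : ℝ → ℝ) (c : ℝ) (k : ℝ → ℝ) : ℝ :=
  (∫ x in (-1 : ℝ)..1, Θ x * (c + prim k x)) - ∫ x in (-1 : ℝ)..1, m x * k x

section

variable {Θ m k l : ℝ → ℝ}

theorem MemL2.intervalIntegrable_mul (hk : MemL2 k) (hl : MemL2 l) :
    IntervalIntegrable (fun x => k x * l x) volume (-1) 1 :=
  integrable_volI_iff.1 (hk.integrable_mul hl)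

theorem MemL2.memL2_const_add_prim (hk : MemL2 k) (c : ℝ) : MemL2 (fun x => c + prim k x) :=
  (memL2_const c).add hk.memL2_prim

theorem dualForm_add_smul (hΘ : MemL2 Θ) (hm : MemL2 m) (c d t : ℝ) (hk : MemL2 k) (hl : MemL2 l) :
    dualForm Θ m (c + t * d) (k + t • l) = dualForm Θ m c k + t * dualForm Θ m d l := by
  have e1 : ∫ x in (-1 : ℝ)..1, Θ x * (c + t * d + prim (k + t • l) x)
      = (∫ x in (-1 : ℝ)..1, Θ x * (c + prim k x))
        + t * ∫ x in (-1 : ℝ)..1, Θ x * (d + prim l x) := by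
    rw [← intervalIntegral.integral_const_mul, ← intervalIntegral.integral_add
      (hΘ.intervalIntegrable_mul (hk.memL2_const_add_prim c))
      ((hΘ.intervalIntegrable_mul (hl.memL2_const_add_prim d)).const_mul t)]
    apply intervalIntegral.integral_congr
    intro x hx
    rw [uIcc_of_le (by norm_num)] at hx
    simp only
    rw [prim_add hk.intervalIntegrable (hl.const_smul t).intervalIntegrable hx, prim_const_smul]
    ring
  have e2 : ∫ x in (-1 : ℝ)..1, m x * (k + t • l) x
      = (∫ x in (-1 : ℝ)..1, m x * k x) + t * ∫ x in (-1 : ℝ)..1, m x * l x := by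
    rw [← intervalIntegral.integral_const_mul, ← intervalIntegral.integral_add
      (hm.intervalIntegrable_mul hk) ((hm.intervalIntegrable_mul hl).const_mul t)]
    congr 1; ext x; simp; ring
  rw [dualForm, e1, e2, dualForm, dualForm]; ring

theorem dualForm_const (c : ℝ) : dualForm Θ m c 0 = c * prim Θ 1 := by
  simp only [dualForm, add_zero, Pi.zero_apply, mul_zero, intervalIntegral.integral_zero,
    sub_zero, intervalIntegral.integral_mul_const, prim]
  ring

/-- Integration by parts in `dualForm`. -/
theorem dualForm_eq (hΘ : MemL2 Θ) (hm : MemL2 m) (c : ℝ) (hk : MemL2 k) :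
    dualForm Θ m c k = prim Θ 1 * (c + prim k 1)
      - ∫ x in (-1 : ℝ)..1, (m + prim Θ) x * k x := by
  have h1 := integral_prim_mul_prim hΘ.intervalIntegrable hk.intervalIntegrable
  have e1 : ∫ x in (-1 : ℝ)..1, Θ x * (c + prim k x)
      = c * prim Θ 1 + ∫ x in (-1 : ℝ)..1, prim k x * Θ x := by
    rw [prim, ← intervalIntegral.integral_const_mul, ← intervalIntegral.integral_add
      (hΘ.intervalIntegrable.const_mul c) (hk.memL2_prim.intervalIntegrable_mul hΘ)]
    congr 1; ext x; ring
  have e2 : ∫ x in (-1 : ℝ)..1, (m + prim Θ) x * k x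
      = (∫ x in (-1 : ℝ)..1, m x * k x) + ∫ x in (-1 : ℝ)..1, k x * prim Θ x := by
    rw [← intervalIntegral.integral_add (hm.intervalIntegrable_mul hk)
      (hk.intervalIntegrable_mul hΘ.memL2_prim)]
    congr 1; ext x; simp; ring
  rw [dualForm, e1, e2, h1]; ring

/-- `dualForm Θ m` is nonnegative at nonnegative functions. -/
def DualNonneg (Θ m : ℝ → ℝ) : Prop :=
  ∀ c k, MemL2 k → (∀ x ∈ Icc (-1 : ℝ) 1, 0 ≤ c + prim k x) → 0 ≤ dualForm Θ m c k

/-- A nonnegative `q` becomes one with positive integral after adding a constant `t > 0`, and the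
effect `t * prim Θ 1` on the form can be made arbitrarily small. -/
theorem dualNonneg_of_pos (hΘ : MemL2 Θ) (hm : MemL2 m)
    (h : ∀ c k, MemL2 k → (∀ x ∈ Icc (-1 : ℝ) 1, 0 ≤ c + prim k x) →
      0 < ∫ x in (-1 : ℝ)..1, (c + prim k x) → 0 ≤ dualForm Θ m c k) : DualNonneg Θ m := by
  intro c k hk hq
  have key : ∀ t : ℝ, 0 < t → 0 ≤ dualForm Θ m c k + t * prim Θ 1 := fun t ht => by
    have h0 : MemL2 (0 : ℝ → ℝ) := memL2_const 0
    have e := dualForm_add_smul hΘ hm c 1 t hk h0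
    rw [dualForm_const, one_mul, smul_zero, add_zero] at e
    rw [← e]
    refine h _ _ hk (fun x hx => by have := hq x hx; linarith) ?_
    have e2 : ∫ x in (-1 : ℝ)..1, (c + t * 1 + prim k x)
        = (∫ x in (-1 : ℝ)..1, (c + prim k x)) + ∫ x in (-1 : ℝ)..1, t := by
      rw [← intervalIntegral.integral_add (hk.memL2_const_add_prim c).intervalIntegrable (by simp)]
      congr 1; ext x; ring
    rw [e2]
    have h3 : 0 ≤ ∫ x in (-1 : ℝ)..1, (c + prim k x) :=
      intervalIntegral.integral_nonneg (by norm_num) hq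
    simp; linarith
  by_contra! hneg
  rcases le_or_gt (prim Θ 1) 0 with hp | hp
  · have := key 1 one_pos
    linarith
  -- This `t` compensates only half of the supposed negative value.
  · have := key (-dualForm Θ m c k / (2 * prim Θ 1)) (div_pos (by linarith) (by linarith))
    have e : -dualForm Θ m c k / (2 * prim Θ 1) * prim Θ 1 = -dualForm Θ m c k / 2 := by
      field_simp
    linarith

/-- A comparison principle for a nonnegative dual form. -/
theorem DualNonneg.dualForm_le (h : DualNonneg Θ m) (hΘ : MemL2 Θ) (hm : MemL2 m) {c d η : ℝ}
    (hk : MemL2 k) (hl : MemL2 l)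
    (hle : ∀ x ∈ Icc (-1 : ℝ) 1, c + prim k x ≤ d + prim l x + η) :
    dualForm Θ m c k ≤ dualForm Θ m d l + η * prim Θ 1 := by
  have h0 : MemL2 (0 : ℝ → ℝ) := memL2_const 0
  have e1 := dualForm_add_smul hΘ hm d 1 η hl h0
  rw [dualForm_const, one_mul, smul_zero, add_zero, mul_one] at e1
  have e2 := dualForm_add_smul hΘ hm (d + η) c (-1) hl hk
  rw [e1] at e2
  have := h (d + η + -1 * c) (l + (-1 : ℝ) • k) (hl.add (hk.const_smul _)) (fun x hx => by
    rw [prim_add hl.intervalIntegrable (hk.const_smul _).intervalIntegrable hx, prim_const_smul]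
    linarith [hle x hx])
  linarith

end

/-- `dualForm` takes a function as initial value and derivative; this puts `mzPrim k` into that
form. -/
theorem mzPrim_left_add_prim (k : ℝ → ℝ) (x : ℝ) : mzPrim k (-1) + prim k x = mzPrim k x := by
  rw [mzPrim, mzPrim, prim_left]; ring

theorem integral_const_add_prim {k : ℝ → ℝ} (hk : MemL2 k) (c : ℝ) :
    ∫ x in (-1 : ℝ)..1, (c + prim k x) = 2 * c + prim (prim k) 1 := by
  rw [intervalIntegral.integral_add (by simp) hk.memL2_prim.intervalIntegrable, prim,
    intervalIntegral.integral_const, smul_eq_mul]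
  ring

/-- The derivative of the reduced functional only depends on the derivative of the direction. -/
theorem redDeriv_eq {β : ℝ} {yd f g l : ℝ → ℝ} (hyd : MemL2 yd) (hg : MemL2 g) (hl : MemL2 l) :
    redDeriv β yd f g l = -dualForm (prim (dirSol g - yd)) (β • (g + f)) (mzPrim l (-1)) l := by
  have he : MemL2 (dirSol g - yd) := hg.memL2_dirSol.sub hyd
  -- Integration by parts moves the derivative onto `dirSol l`. The boundary terms vanish because
  -- `dirSol l` is zero at both ends.
  have h1 := integral_prim_mul_prim he.intervalIntegrable hl.memL2_mzPrim.intervalIntegrable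
  change ∫ x in (-1 : ℝ)..1, dirSol l x * (dirSol g - yd) x = dirSol l 1 * _ - _ at h1
  rw [hl.dirSol_right, zero_mul, zero_sub] at h1
  simp only [dualForm, mzPrim_left_add_prim]
  rw [redDeriv, integral_volI, integral_volI]
  simp only [mul_comm _ (dirSol l _), mul_comm _ (mzPrim l _), h1]
  simp only [Pi.smul_apply, smul_eq_mul, mul_assoc, intervalIntegral.integral_const_mul]
  ring

/-- Existence of the multiplier: a nonnegative functional that vanishes at the slack
`ψ - mzPrim g` and represents the derivative of the reduced functional. -/
theorem IsRedMin.exists_multiplier {β : ℝ} {yd f ψ ψ' g : ℝ → ℝ}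
    (hyd : MemL2 yd) (hf : MemL2 f) (hψ' : MemL2 ψ')
    (hψ : ∀ x ∈ Icc (-1 : ℝ) 1, ψ x = ψ (-1) + prim ψ' x)
    (hpos : 0 < ∫ x in (-1 : ℝ)..1, ψ x) (hg : IsRedMin β yd f (Constraint ψ) g) :
    ∃ Θ : ℝ → ℝ, ContinuousOn Θ (Icc (-1) 1) ∧ DualNonneg Θ (β • (g + f)) ∧
      dualForm Θ (β • (g + f)) (ψ (-1) - mzPrim g (-1)) (ψ' - g) = 0 ∧
      ∀ l, MemL2 l → redDeriv β yd f g l = -dualForm Θ (β • (g + f)) (mzPrim l (-1)) l := by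
  have hg2 := hg.1
  have hP : IsClosedConvexL2 (Constraint ψ) := isClosedConvexL2_constraint ⟨g, hg2, hg.2.1⟩
  have he : MemL2 (dirSol g - yd) := hg2.memL2_dirSol.sub hyd
  set G := prim (dirSol g - yd)
  set m := β • (g + f)
  have hm : MemL2 m := (hg2.add hf).const_smul β
  have hG : MemL2 G := he.memL2_prim
  set d := ψ (-1) - mzPrim g (-1)
  have hδ : MemL2 (ψ' - g) := hψ'.sub hg2
  have hδeq : ∀ x ∈ Icc (-1 : ℝ) 1, d + prim (ψ' - g) x = ψ x - mzPrim g x := fun x hx => by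
    rw [prim_sub hψ'.intervalIntegrable hg2.intervalIntegrable hx, hψ x hx,
      ← mzPrim_left_add_prim g x]
    simp only [d]; ring
  -- The state derivative has mean zero, so the integral of the slack equals that of `ψ`.
  have hδint : 0 < ∫ x in (-1 : ℝ)..1, (d + prim (ψ' - g) x) := by
    have e : ∫ x in (-1 : ℝ)..1, (d + prim (ψ' - g) x) = ∫ x in (-1 : ℝ)..1, (ψ x - mzPrim g x) := by
      apply intervalIntegral.integral_congr
      intro x hx
      rw [uIcc_of_le (by norm_num)] at hx
      exact hδeq x hx
    have hψc : ContinuousOn ψ (Icc (-1) 1) :=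
      (continuousOn_const.add (continuousOn_prim hψ'.intervalIntegrable)).congr hψ
    rw [e, intervalIntegral.integral_sub (memL2_of_continuousOn hψc).intervalIntegrable
      hg2.memL2_mzPrim.intervalIntegrable, hg2.integral_mzPrim, sub_zero]
    exact hpos
  set D := ∫ x in (-1 : ℝ)..1, (d + prim (ψ' - g) x) with hD
  -- The free multiple of `∫ q`, fixed so that the form vanishes at the slack.
  set μ := -dualForm G m d (ψ' - g) / D with hμ
  set Θ : ℝ → ℝ := fun x => μ + G x
  have hΘc : ContinuousOn Θ (Icc (-1) 1) :=
    continuousOn_const.add (continuousOn_prim he.intervalIntegrable)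
  have hΘ : ∀ c k, MemL2 k → dualForm Θ m c k
      = μ * (∫ x in (-1 : ℝ)..1, (c + prim k x)) + dualForm G m c k := fun c k hk => by
    have e : ∫ x in (-1 : ℝ)..1, Θ x * (c + prim k x)
        = μ * (∫ x in (-1 : ℝ)..1, (c + prim k x)) + ∫ x in (-1 : ℝ)..1, G x * (c + prim k x) := by
      rw [← intervalIntegral.integral_const_mul, ← intervalIntegral.integral_add
        ((hk.memL2_const_add_prim c).intervalIntegrable.const_mul μ)
        (hG.intervalIntegrable_mul (hk.memL2_const_add_prim c))]
      congr 1; ext x; simp only [Θ]; ring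
    rw [dualForm, e, dualForm]; ring
  refine ⟨Θ, hΘc, dualNonneg_of_pos (memL2_of_continuousOn hΘc) hm fun c k hk hq hqpos => ?_,
    ?_, fun l hl => ?_⟩
  · set R := ∫ x in (-1 : ℝ)..1, (c + prim k x) with hR
    -- This scaling gives slack and `t q` the same integral. Their difference has mean zero and so
    -- is the derivative of the admissible direction `dirSol l`; moving `g` by `l` turns the state
    -- derivative into `ψ - t q ≤ ψ`.
    set t := D / R with ht
    have htR : t * R = D := div_mul_cancel₀ _ hqpos.ne'
    have htpos : 0 < t := div_pos hδint hqpos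
    set l := ψ' - g + (-t) • k with hl'
    have hl : MemL2 l := hδ.add (hk.const_smul _)
    have hlprim : ∀ x ∈ Icc (-1 : ℝ) 1, prim l x = prim (ψ' - g) x - t * prim k x := fun x hx => by
      rw [hl', prim_add hδ.intervalIntegrable (hk.const_smul _).intervalIntegrable hx,
        prim_const_smul]; ring
    have hlpp : prim (prim l) 1 = prim (prim (ψ' - g)) 1 - t * prim (prim k) 1 := by
      rw [prim_eqOn (l := prim (ψ' - g) + (-t) • prim k) (fun x hx => by
        rw [hlprim x hx]; simp; ring) right_mem, prim_add hδ.memL2_prim.intervalIntegrable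
        (hk.memL2_prim.const_smul _).intervalIntegrable right_mem, prim_const_smul]; ring
    have hlm : mzPrim l (-1) = d - t * c := by
      rw [integral_const_add_prim hδ] at hD
      rw [integral_const_add_prim hk] at hR
      rw [mzPrim, prim_left, hlpp]
      have : t * (2 * c + prim (prim k) 1) = 2 * d + prim (prim (ψ' - g)) 1 := by
        rw [← hR, ← hD, htR]
      linarith
    have hadm : Constraint ψ (g + l) := fun x hx => by
      rw [mzPrim_add hg2 hl hx, ← mzPrim_left_add_prim l, hlm, hlprim x hx]
      have h1 := hδeq x hx
      have h2 := mul_nonneg htpos.le (hq x hx)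
      linarith
    have hVI := hg.redDeriv_nonneg hP hyd hf (hg2.add hl) hadm
    rw [add_sub_cancel_left, redDeriv_eq hyd hg2 hl, hlm] at hVI
    have e := dualForm_add_smul hG hm d c (-t) hδ hk
    rw [show d + -t * c = d - t * c by ring, ← hl'] at e
    rw [e] at hVI
    rw [hΘ c k hk, ← hR]
    have hμD : μ * D = -dualForm G m d (ψ' - g) := div_mul_cancel₀ _ hδint.ne'
    have : 0 ≤ t * (μ * R + dualForm G m c k) := by
      have : t * (μ * R) = μ * D := by rw [← htR]; ring
      linarith
    exact nonneg_of_mul_nonneg_right this htpos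
  · rw [hΘ _ _ hδ, ← hD, hμ, div_mul_cancel₀ _ hδint.ne']; ring
  -- The added multiple of the integral is invisible to mean-zero functions.
  · rw [hΘ _ _ hl, redDeriv_eq hyd hg2 hl]
    simp only [mzPrim_left_add_prim]
    rw [hl.integral_mzPrim]; ring

/-! ### Regularity: the dual form has a monotone density -/

theorem memL2_indicator_Ioc (a b : ℝ) : MemL2 ((Ioc a b).indicator 1) :=
  MemLp.indicator measurableSet_Ioc (memL2_const 1)

theorem integral_mul_indicator_Ioc (F : ℝ → ℝ) {a b : ℝ} (ha : -1 ≤ a) (hab : a ≤ b) (hb : b ≤ 1) :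
    ∫ x in (-1 : ℝ)..1, F x * (Ioc a b).indicator 1 x = ∫ x in a..b, F x := by
  have : ∀ x, F x * (Ioc a b).indicator 1 x = (Ioc a b).indicator F x := fun x => by
    by_cases hx : x ∈ Ioc a b <;> simp [hx]
  simp_rw [this]
  rw [intervalIntegral.integral_of_le (by norm_num), setIntegral_indicator measurableSet_Ioc,
    intervalIntegral.integral_of_le hab, inter_eq_self_of_subset_right (Ioc_subset_Ioc ha hb)]

theorem prim_indicator_Ioc {a b x : ℝ} (ha : -1 ≤ a) (hab : a ≤ b) (hx : -1 ≤ x) :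
    prim ((Ioc a b).indicator 1) x = min b x - min a x := by
  rw [prim, intervalIntegral.integral_of_le hx, setIntegral_indicator measurableSet_Ioc,
    Ioc_inter_Ioc]
  simp only [Pi.one_apply, integral_const, smul_eq_mul, mul_one, measureReal_restrict_apply_univ,
    Real.volume_real_Ioc, max_eq_right ha]
  rcases max_cases (min x b - a) 0 with h | h <;> rcases min_cases x b with h1 | h1 <;>
    rcases min_cases b x with h2 | h2 <;> rcases min_cases a x with h3 | h3 <;> linarith

section

variable {Θ m : ℝ → ℝ}

/-- Test function: a ramp falling from `t` to `0` across the interval. It vanishes at `1`, so only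
the integral of the density remains. -/
theorem DualNonneg.integral_nonneg (h : DualNonneg Θ m) (hΘ : MemL2 Θ) (hm : MemL2 m)
    {x t : ℝ} (hx : -1 ≤ x) (ht : 0 ≤ t) (hxt : x + t ≤ 1) :
    0 ≤ ∫ s in x..x + t, (m + prim Θ) s := by
  have h1 := h t ((-1 : ℝ) • (Ioc x (x + t)).indicator 1)
    ((memL2_indicator_Ioc _ _).const_smul _) (fun z hz => by
      rw [prim_const_smul, prim_indicator_Ioc hx (by linarith) hz.1]
      rcases min_cases (x + t) z with h1 | h1 <;> rcases min_cases x z with h2 | h2 <;> linarith)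
  rw [dualForm_eq hΘ hm _ ((memL2_indicator_Ioc _ _).const_smul _), prim_const_smul,
    prim_indicator_Ioc hx (by linarith) (by norm_num), min_eq_left hxt, min_eq_left (by linarith)]
    at h1
  simp only [Pi.smul_apply, smul_eq_mul, mul_left_comm _ (-1 : ℝ),
    intervalIntegral.integral_const_mul] at h1
  rw [integral_mul_indicator_Ioc _ hx (by linarith) hxt] at h1
  linarith

/-- Test function: a ramp rising from `0` to `t`, whose value at `1` produces the upper bound. -/
theorem DualNonneg.integral_le (h : DualNonneg Θ m) (hΘ : MemL2 Θ) (hm : MemL2 m)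
    {x t : ℝ} (hx : -1 ≤ x) (ht : 0 ≤ t) (hxt : x + t ≤ 1) :
    ∫ s in x..x + t, (m + prim Θ) s ≤ prim Θ 1 * t := by
  have h1 := h 0 ((Ioc x (x + t)).indicator 1) (memL2_indicator_Ioc _ _) (fun z hz => by
      rw [prim_indicator_Ioc hx (by linarith) hz.1]
      rcases min_cases (x + t) z with h1 | h1 <;> rcases min_cases x z with h2 | h2 <;> linarith)
  rw [dualForm_eq hΘ hm _ (memL2_indicator_Ioc _ _),
    prim_indicator_Ioc hx (by linarith) (by norm_num), min_eq_left hxt, min_eq_left (by linarith),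
    integral_mul_indicator_Ioc _ hx (by linarith) hxt] at h1
  linarith

/-- Test function: a trapezoid that rises on `(x, x + t)` and falls on `(y, y + t)`. Comparing
averages over intervals of equal length replaces comparing point values. -/
theorem DualNonneg.integral_mono (h : DualNonneg Θ m) (hΘ : MemL2 Θ) (hm : MemL2 m)
    {x y t : ℝ} (hx : -1 ≤ x) (ht : 0 ≤ t) (hxy : x + t ≤ y) (hyt : y + t ≤ 1) :
    ∫ s in x..x + t, (m + prim Θ) s ≤ ∫ s in y..y + t, (m + prim Θ) s := by
  have hi := memL2_indicator_Ioc x (x + t)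
  have hj := (memL2_indicator_Ioc y (y + t)).const_smul (-1)
  have hp : ∀ z ∈ Icc (-1 : ℝ) 1, prim ((Ioc x (x + t)).indicator 1
      + (-1 : ℝ) • (Ioc y (y + t)).indicator 1) z
      = (min (x + t) z - min x z) - (min (y + t) z - min y z) := fun z hz => by
    rw [prim_add hi.intervalIntegrable hj.intervalIntegrable hz, prim_const_smul,
      prim_indicator_Ioc hx (by linarith) hz.1, prim_indicator_Ioc (by linarith) (by linarith) hz.1]
    ring
  have h1 := h 0 _ (hi.add hj) (fun z hz => by
    rw [hp z hz]
    rcases min_cases (x + t) z with h1 | h1 <;> rcases min_cases x z with h2 | h2 <;>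
      rcases min_cases (y + t) z with h3 | h3 <;> rcases min_cases y z with h4 | h4 <;> linarith)
  rw [dualForm_eq hΘ hm _ (hi.add hj), hp 1 right_mem, min_eq_left (by linarith),
    min_eq_left (by linarith), min_eq_left hyt, min_eq_left (by linarith)] at h1
  have hw : MemL2 (m + prim Θ) := hm.add hΘ.memL2_prim
  have e : ∫ s in (-1 : ℝ)..1, (m + prim Θ) s * ((Ioc x (x + t)).indicator (1 : ℝ → ℝ)
      + (-1 : ℝ) • (Ioc y (y + t)).indicator (1 : ℝ → ℝ)) s
      = (∫ s in x..x + t, (m + prim Θ) s) - ∫ s in y..y + t, (m + prim Θ) s := by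
    rw [← integral_mul_indicator_Ioc _ hx (by linarith) (by linarith),
      ← integral_mul_indicator_Ioc _ (by linarith : -1 ≤ y) (by linarith) hyt,
      ← intervalIntegral.integral_sub (hw.intervalIntegrable_mul (memL2_indicator_Ioc _ _))
        (hw.intervalIntegrable_mul (memL2_indicator_Ioc _ _))]
    congr 1; ext s
    simp only [Pi.add_apply, Pi.smul_apply, smul_eq_mul]; ring
  rw [e] at h1
  linarith

/-- A nonnegative dual form has a monotone density. -/
theorem DualNonneg.exists_monotone (h : DualNonneg Θ m) (hΘ : MemL2 Θ) (hm : MemL2 m) :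
    ∃ ρ : ℝ → ℝ, Monotone ρ ∧ m + prim Θ =ᵐ[volI] ρ := by
  set w := m + prim Θ with hw'
  have hw : MemL2 w := hm.add hΘ.memL2_prim
  -- On this set of full measure the one-sided averages of `w` converge to `w x`, so inequalities
  -- between averages pass to point values.
  set S : Set ℝ := {x | x ∈ I ∧ HasDerivAt (prim w) (w x) x}
  have hS : ∀ᵐ x ∂volI, x ∈ S := by
    rw [ae_volI_iff]
    filter_upwards [ae_deriv_prim hw.intervalIntegrable] with x hx hxI
    exact ⟨hxI, hx (Ioo_subset_Icc_self hxI)⟩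
  have hlim : ∀ x ∈ S, Filter.Tendsto (fun t => t⁻¹ * ∫ s in x..x + t, w s) (nhdsWithin 0 (Ioi 0))
      (nhds (w x)) := fun x hx => by
    refine hx.2.tendsto_slope_zero_right.congr' ?_
    have hx1 : 0 < 1 - x := by linarith [hx.1.2]
    filter_upwards [Ioo_mem_nhdsGT hx1] with t ht
    rw [smul_eq_mul, prim_sub_prim hw.intervalIntegrable (Ioo_subset_Icc_self hx.1)
      ⟨by linarith [hx.1.1, ht.1], by linarith [ht.2]⟩]
  have hmono : MonotoneOn w S := by
    intro x hx y hy hxy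
    rcases hxy.eq_or_lt with rfl | hxy
    · rfl
    refine le_of_tendsto_of_tendsto (hlim x hx) (hlim y hy) ?_
    have h1 : 0 < min (y - x) (1 - y) := lt_min (by linarith) (by linarith [hy.1.2])
    filter_upwards [Ioo_mem_nhdsGT h1] with t ht
    have h2 := ht.2.le.trans (min_le_left _ _)
    have h3 := ht.2.le.trans (min_le_right _ _)
    exact mul_le_mul_of_nonneg_left (h.integral_mono hΘ hm hx.1.1.le ht.1.le (by linarith)
      (by linarith)) (inv_nonneg.2 ht.1.le)
  have hev : ∀ x ∈ S, ∀ᶠ t in nhdsWithin (0 : ℝ) (Ioi 0),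
      0 ≤ t⁻¹ * ∫ s in x..x + t, w s ∧ t⁻¹ * ∫ s in x..x + t, w s ≤ prim Θ 1 := fun x hx => by
    have hx1 : 0 < 1 - x := by linarith [hx.1.2]
    filter_upwards [Ioo_mem_nhdsGT hx1] with t ht
    refine ⟨mul_nonneg (inv_nonneg.2 ht.1.le) (h.integral_nonneg hΘ hm hx.1.1.le ht.1.le
      (by linarith [ht.2])), ?_⟩
    rw [inv_mul_le_iff₀ ht.1, mul_comm]
    exact h.integral_le hΘ hm hx.1.1.le ht.1.le (by linarith [ht.2])
  -- The uniform bounds on `S` are what allows a monotone extension to the whole line.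
  obtain ⟨ρ, hρ, hρw⟩ := hmono.exists_monotone_extension
    ⟨0, by
      rintro _ ⟨x, hx, rfl⟩
      exact ge_of_tendsto (hlim x hx) ((hev x hx).mono fun _ h => h.1)⟩
    ⟨prim Θ 1, by
      rintro _ ⟨x, hx, rfl⟩
      exact le_of_tendsto (hlim x hx) ((hev x hx).mono fun _ h => h.2)⟩
  exact ⟨ρ, hρ, hS.mono fun x hx => hρw hx⟩

end

/-! ### Approximation by piecewise constant functions -/

/-- `k` is approximated in `L₂(I)` by piecewise constant functions with order `α`. -/
def HasRate (α : ℝ) (k : ℝ → ℝ) : Prop :=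
  MemL2 k ∧ ∃ C : ℝ, 0 ≤ C ∧ ∀ M : Mesh, ∃ c : Fin M.n → ℝ,
    ∑ i, ∫ x in M.node i.castSucc..M.node i.succ, (k x - c i) ^ 2 ≤ C * M.h ^ (2 * α)

/-- The mesh size is at most `2`, so a higher power is dominated by a lower one up to a constant. -/
theorem rpow_h_le (M : Mesh) {α α' : ℝ} (h : α ≤ α') : M.h ^ α' ≤ 2 ^ (α' - α) * M.h ^ α := by
  have h0 := M.h_pos
  calc M.h ^ α' = M.h ^ (α' - α) * M.h ^ α := by rw [← Real.rpow_add h0]; ring_nf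
    _ ≤ _ := by
      gcongr
      exact M.h_le_two

section

variable {α : ℝ} {k l : ℝ → ℝ}

theorem MemL2.intervalIntegrable_sub_sq (hk : MemL2 k) (c : ℝ) {a b : ℝ}
    (ha : a ∈ Icc (-1 : ℝ) 1) (hb : b ∈ Icc (-1 : ℝ) 1) :
    IntervalIntegrable (fun x => (k x - c) ^ 2) volume a b :=
  intervalIntegrable_of_Icc (hk.sub (memL2_const c)).intervalIntegrable_sq ha hb

theorem Mesh.intervalIntegral_congr {M : Mesh} {F G : ℝ → ℝ} (h : F =ᵐ[volI] G) (i : Fin M.n) :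
    ∫ x in M.node i.castSucc..M.node i.succ, F x = ∫ x in M.node i.castSucc..M.node i.succ, G x := by
  rw [intervalIntegral.integral_of_le (M.node_lt i).le,
    intervalIntegral.integral_of_le (M.node_lt i).le, integral_Ioc_eq_integral_Ioo,
    integral_Ioc_eq_integral_Ioo]
  refine setIntegral_congr_ae measurableSet_Ioo ?_
  filter_upwards [ae_volI_iff.1 h] with x hx hxi
  exact hx ⟨(M.node_mem _).1.trans_lt hxi.1, hxi.2.trans_le (M.node_mem _).2⟩

theorem HasRate.congr (hk : HasRate α k) (h : k =ᵐ[volI] l) : HasRate α l := by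
  obtain ⟨hk2, C, hC, hM⟩ := hk
  refine ⟨hk2.congr h, C, hC, fun M => ?_⟩
  obtain ⟨c, hc⟩ := hM M
  refine ⟨c, le_of_eq_of_le (Finset.sum_congr rfl fun i _ => ?_) hc⟩
  exact Mesh.intervalIntegral_congr (by filter_upwards [h] with x hx; rw [hx]) i

theorem HasRate.const_smul (hk : HasRate α k) (t : ℝ) : HasRate α (t • k) := by
  obtain ⟨hk2, C, hC, hM⟩ := hk
  refine ⟨hk2.const_smul t, t ^ 2 * C, by positivity, fun M => ?_⟩
  obtain ⟨c, hc⟩ := hM M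
  refine ⟨t • c, ?_⟩
  have : ∀ i x, ((t • k) x - (t • c) i) ^ 2 = t ^ 2 * (k x - c i) ^ 2 := fun i x => by
    simp; ring
  simp_rw [this, intervalIntegral.integral_const_mul, ← Finset.mul_sum, mul_assoc]
  gcongr

theorem HasRate.add (hk : HasRate α k) (hl : HasRate α l) : HasRate α (k + l) := by
  obtain ⟨hk2, C, hC, hM⟩ := hk
  obtain ⟨hl2, C', hC', hM'⟩ := hl
  refine ⟨hk2.add hl2, 2 * C + 2 * C', by positivity, fun M => ?_⟩
  obtain ⟨c, hc⟩ := hM M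
  obtain ⟨c', hc'⟩ := hM' M
  refine ⟨c + c', ?_⟩
  calc ∑ i, ∫ x in M.node i.castSucc..M.node i.succ, ((k + l) x - (c + c') i) ^ 2
      ≤ ∑ i, (2 * (∫ x in M.node i.castSucc..M.node i.succ, (k x - c i) ^ 2)
        + 2 * ∫ x in M.node i.castSucc..M.node i.succ, (l x - c' i) ^ 2) := by
        refine Finset.sum_le_sum fun i _ => ?_
        have ha := M.node_mem i.castSucc
        have hb := M.node_mem i.succ
        have i1 := (hk2.intervalIntegrable_sub_sq (c i) ha hb).const_mul 2
        have i2 := (hl2.intervalIntegrable_sub_sq (c' i) ha hb).const_mul 2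
        rw [← intervalIntegral.integral_const_mul, ← intervalIntegral.integral_const_mul,
          ← intervalIntegral.integral_add i1 i2]
        refine intervalIntegral.integral_mono_on (M.node_lt i).le
          ((hk2.add hl2).intervalIntegrable_sub_sq _ ha hb) (i1.add i2) fun x _ => ?_
        simp only [Pi.add_apply]
        nlinarith [sq_nonneg ((k x - c i) - (l x - c' i))]
    _ = 2 * (∑ i, ∫ x in M.node i.castSucc..M.node i.succ, (k x - c i) ^ 2)
        + 2 * ∑ i, ∫ x in M.node i.castSucc..M.node i.succ, (l x - c' i) ^ 2 := by
        rw [Finset.sum_add_distrib, Finset.mul_sum, Finset.mul_sum]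
    _ ≤ (2 * C + 2 * C') * M.h ^ (2 * α) := by linarith

theorem HasRate.sub (hk : HasRate α k) (hl : HasRate α l) : HasRate α (k - l) := by
  have := hk.add (hl.const_smul (-1))
  rwa [neg_one_smul, ← sub_eq_add_neg] at this

theorem memL2_of_monotoneOn (hk : MonotoneOn k (Icc (-1) 1)) : MemL2 k := by
  refine MemLp.of_bound (aemeasurable_restrict_of_monotoneOn measurableSet_Ioo
    (hk.mono Ioo_subset_Icc_self)).aestronglyMeasurable (max |k (-1)| |k 1|) ?_
  filter_upwards [ae_mem_I] with x hx
  have hx := Ioo_subset_Icc_self hx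
  exact abs_le_max_abs_abs (hk left_mem hx hx.1) (hk hx right_mem hx.2)

/-- On a cell the squared error is at most `h` times the squared increment. The increments are
nonnegative, so the sum of their squares is at most the square of the total increment; what remains
is one factor `h`, that is, order `1/2`. -/
theorem hasRate_of_monotoneOn (hk : MonotoneOn k (Icc (-1) 1)) (hα : α ≤ 1 / 2) : HasRate α k := by
  have hk2 := memL2_of_monotoneOn hk
  have hB : 0 ≤ k 1 - k (-1) := sub_nonneg.2 (hk left_mem right_mem (by norm_num))
  refine ⟨hk2, 2 ^ (1 - 2 * α) * (k 1 - k (-1)) ^ 2, by positivity, fun M =>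
    ⟨fun i => k (M.node i.castSucc), ?_⟩⟩
  have hΔ : ∀ i : Fin M.n, 0 ≤ k (M.node i.succ) - k (M.node i.castSucc) := fun i =>
    sub_nonneg.2 (hk (M.node_mem _) (M.node_mem _) (M.node_lt i).le)
  have hsum : ∑ i : Fin M.n, (k (M.node i.succ) - k (M.node i.castSucc)) = k 1 - k (-1) := by
    rw [sum_fin_sub_telescope (fun j => k (M.node j)), M.node_zero, M.node_last]
  calc ∑ i : Fin M.n, ∫ x in M.node i.castSucc..M.node i.succ, (k x - k (M.node i.castSucc)) ^ 2
      ≤ ∑ i : Fin M.n, M.h * (k (M.node i.succ) - k (M.node i.castSucc)) ^ 2 := by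
        refine Finset.sum_le_sum fun i _ => ?_
        have h1 : ∫ x in M.node i.castSucc..M.node i.succ, (k x - k (M.node i.castSucc)) ^ 2
            ≤ ∫ x in M.node i.castSucc..M.node i.succ,
              (k (M.node i.succ) - k (M.node i.castSucc)) ^ 2 := by
          refine intervalIntegral.integral_mono_on (M.node_lt i).le
            (hk2.intervalIntegrable_sub_sq _ (M.node_mem _) (M.node_mem _)) (by simp)
            fun x hx => ?_
          have hxI := M.cell_subset i hx
          have h2 := hk (M.node_mem i.castSucc) hxI hx.1
          have h3 := hk hxI (M.node_mem i.succ) hx.2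
          exact pow_le_pow_left₀ (by linarith) (by linarith) 2
        refine h1.trans ?_
        rw [intervalIntegral.integral_const, smul_eq_mul]
        exact mul_le_mul_of_nonneg_right (M.len_le_h i) (sq_nonneg _)
    _ = M.h * ∑ i : Fin M.n, (k (M.node i.succ) - k (M.node i.castSucc)) ^ 2 := by
        rw [Finset.mul_sum]
    _ ≤ M.h * (k 1 - k (-1)) ^ 2 := by
        rw [← hsum]
        exact mul_le_mul_of_nonneg_left
          (Finset.sum_sq_le_sq_sum_of_nonneg fun i _ => hΔ i) M.h_pos.le
    _ ≤ 2 ^ (1 - 2 * α) * (k 1 - k (-1)) ^ 2 * M.h ^ (2 * α) := by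
        have := rpow_h_le M (show 2 * α ≤ 1 by linarith)
        rw [Real.rpow_one] at this
        nlinarith [sq_nonneg (k 1 - k (-1))]

/-- A primitive of a continuous function is a difference of monotone functions. -/
theorem hasRate_prim (hk : ContinuousOn k (Icc (-1) 1)) (hα : α ≤ 1 / 2) : HasRate α (prim k) := by
  obtain ⟨C, hC⟩ := isCompact_Icc.exists_bound_of_continuousOn hk
  have hk2 := memL2_of_continuousOn hk
  have hC0 : 0 ≤ C := (norm_nonneg _).trans (hC _ left_mem)
  have h1 : MonotoneOn (fun x => C * x) (Icc (-1) 1) := fun x _ y _ hxy =>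
    mul_le_mul_of_nonneg_left hxy hC0
  have h2 : MonotoneOn (fun x => prim k x + C * x) (Icc (-1) 1) := fun x hx y hy hxy => by
    have h3 := prim_sub_prim hk2.intervalIntegrable hx hy
    have h4 : ‖∫ t in x..y, k t‖ ≤ C * |y - x| :=
      intervalIntegral.norm_integral_le_of_norm_le_const fun t ht => by
        rw [uIoc_of_le hxy] at ht
        exact hC t ⟨hx.1.trans ht.1.le, ht.2.trans hy.2⟩
    rw [← h3, Real.norm_eq_abs, abs_of_nonneg (sub_nonneg.2 hxy), abs_le] at h4
    simp only
    linarith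
  have := (hasRate_of_monotoneOn h2 hα).sub (hasRate_of_monotoneOn h1 hα)
  convert this using 1
  ext x; simp

end

/-- A function with finite Gagliardo seminorm is close to one of its values on every interval. -/
theorem exists_lintegral_sub_sq_le {σ : ℝ} (hσ : 0 < σ) {k : ℝ → ℝ} (hk : MemL2 k) {a b : ℝ}
    (ha : -1 ≤ a) (hab : a < b) (hb : b ≤ 1) :
    ∃ c : ℝ, ∫⁻ x in Ioo a b, ENNReal.ofReal ((k x - c) ^ 2) ≤
      ENNReal.ofReal ((b - a) ^ (2 * σ)) * ∫⁻ x in Ioo a b, ∫⁻ y,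
        ENNReal.ofReal ((k x - k y) ^ 2 / |x - y| ^ (1 + 2 * σ)) ∂volI := by
  have hpos : 0 < b - a := sub_pos.2 hab
  have hsub : Ioo a b ⊆ I := Ioo_subset_Ioo ha hb
  set μ := volume.restrict (Ioo a b)
  have hkm : AEMeasurable k μ := hk.1.aemeasurable.mono_measure (Measure.restrict_mono hsub le_rfl)
  have hmeas : AEMeasurable (fun x => ∫⁻ y in Ioo a b, ENNReal.ofReal ((k x - k y) ^ 2)) μ := by
    have h1 : AEMeasurable (fun z : ℝ × ℝ => ENNReal.ofReal ((k z.1 - k z.2) ^ 2)) (μ.prod μ) :=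
      (((hkm.comp_quasiMeasurePreserving Measure.quasiMeasurePreserving_fst).sub
        (hkm.comp_quasiMeasurePreserving Measure.quasiMeasurePreserving_snd)).pow_const
          2).ennreal_ofReal
    exact h1.lintegral_prod_right'
  have hvol : volume (Ioo a b) = ENNReal.ofReal (b - a) := Real.volume_Ioo
  -- Some point `s` has an inner integral no larger than the average; `k s` serves as the constant.
  obtain ⟨s, hs, hle⟩ := exists_le_setLAverage (μ := volume) (s := Ioo a b)
    (by rw [hvol]; simpa using hab) (by rw [hvol]; simp) hmeas
  refine ⟨k s, ?_⟩
  rw [setLAverage_eq, hvol] at hle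
  have hle' : ∫⁻ y in Ioo a b, ENNReal.ofReal ((k y - k s) ^ 2)
      = ∫⁻ y in Ioo a b, ENNReal.ofReal ((k s - k y) ^ 2) := by
    simp_rw [sub_sq_comm (k s)]
  rw [hle']
  refine hle.trans ?_
  -- Inserting the Gagliardo kernel costs `(b - a) ^ (1 + 2σ)`; one factor cancels against the
  -- averaging.
  have hpow : (b - a) ^ (1 + 2 * σ) = (b - a) * (b - a) ^ (2 * σ) := by
    rw [Real.rpow_add hpos, Real.rpow_one]
  have hin : ∀ x ∈ Ioo a b, ∫⁻ y in Ioo a b, ENNReal.ofReal ((k x - k y) ^ 2) ≤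
      ENNReal.ofReal ((b - a) ^ (1 + 2 * σ)) * ∫⁻ y,
        ENNReal.ofReal ((k x - k y) ^ 2 / |x - y| ^ (1 + 2 * σ)) ∂volI := fun x hx => by
    rw [← lintegral_const_mul' _ _ ENNReal.ofReal_ne_top]
    refine le_trans ?_ (lintegral_mono' (Measure.restrict_mono hsub le_rfl) le_rfl)
    refine setLIntegral_mono' measurableSet_Ioo fun y hy => ?_
    rw [← ENNReal.ofReal_mul (by positivity)]
    apply ENNReal.ofReal_le_ofReal
    rcases eq_or_ne x y with rfl | hxy
    · simp
    have h0 : 0 < |x - y| := abs_pos.2 (sub_ne_zero.2 hxy)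
    have h1 : |x - y| ≤ b - a := by
      rw [abs_le]; constructor <;> linarith [hx.1, hx.2, hy.1, hy.2]
    have h2 : |x - y| ^ (1 + 2 * σ) ≤ (b - a) ^ (1 + 2 * σ) :=
      Real.rpow_le_rpow h0.le h1 (by linarith)
    have h3 : 0 < |x - y| ^ (1 + 2 * σ) := Real.rpow_pos_of_pos h0 _
    rw [mul_div_assoc', le_div_iff₀ h3, mul_comm]
    exact mul_le_mul_of_nonneg_right h2 (sq_nonneg _)
  have hout := setLIntegral_mono' (μ := volume) measurableSet_Ioo hin
  rw [lintegral_const_mul' _ _ ENNReal.ofReal_ne_top, hpow, ENNReal.ofReal_mul hpos.le,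
    mul_assoc] at hout
  refine ENNReal.div_le_of_le_mul ?_
  rwa [mul_comm]

/-- The local bounds contain double integrals over cell times `I`. The cells are disjoint, so these
add up to at most the full seminorm. -/
theorem hasRate_of_gagliardoFinite {σ : ℝ} (hσ : 0 < σ) {k : ℝ → ℝ} (hk : MemL2 k)
    (hG : GagliardoFinite σ k) : HasRate σ k := by
  set Γ := ∫⁻ x, ∫⁻ y, ENNReal.ofReal ((k x - k y) ^ 2 / |x - y| ^ (1 + 2 * σ)) ∂volI ∂volI with hΓ
  have hΓ' : Γ ≠ ⊤ := ne_of_lt hG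
  refine ⟨hk, Γ.toReal, ENNReal.toReal_nonneg, fun M => ?_⟩
  choose c hc using fun i : Fin M.n => exists_lintegral_sub_sq_le hσ hk
    (M.node_mem i.castSucc).1 (M.node_lt i) (M.node_mem i.succ).2
  refine ⟨c, ?_⟩
  have hcell : ∀ i : Fin M.n, ENNReal.ofReal
      (∫ x in M.node i.castSucc..M.node i.succ, (k x - c i) ^ 2) =
      ∫⁻ x in Ioo (M.node i.castSucc) (M.node i.succ), ENNReal.ofReal ((k x - c i) ^ 2) :=
    fun i => by
      have hint := hk.intervalIntegrable_sub_sq (c i) (M.node_mem i.castSucc) (M.node_mem i.succ)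
      rw [intervalIntegrable_iff_integrableOn_Ioo_of_le (M.node_lt i).le] at hint
      rw [intervalIntegral.integral_of_le (M.node_lt i).le, integral_Ioc_eq_integral_Ioo,
        ofReal_integral_eq_lintegral_ofReal hint (Filter.Eventually.of_forall
          fun _ => sq_nonneg _)]
  have hdisj : Set.PairwiseDisjoint ((Finset.univ : Finset (Fin M.n)) : Set (Fin M.n))
      fun i : Fin M.n => Ioo (M.node i.castSucc) (M.node i.succ) := by
    intro i _ j _ hij
    refine Set.disjoint_left.2 fun x hx hx' => hij ?_
    exact M.eq_of_mem_Ioc (Ioo_subset_Ioc_self hx) (Ioo_subset_Ioc_self hx')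
  have h0 : ∀ i : Fin M.n, 0 ≤ ∫ x in M.node i.castSucc..M.node i.succ, (k x - c i) ^ 2 :=
    fun i => intervalIntegral.integral_nonneg (M.node_lt i).le fun _ _ => sq_nonneg _
  have key : ENNReal.ofReal (∑ i, ∫ x in M.node i.castSucc..M.node i.succ, (k x - c i) ^ 2) ≤
      ENNReal.ofReal (M.h ^ (2 * σ)) * Γ := by
    rw [ENNReal.ofReal_sum_of_nonneg fun i _ => h0 i]
    simp_rw [hcell]
    refine (Finset.sum_le_sum fun i _ => (hc i).trans (mul_le_mul_left (ENNReal.ofReal_le_ofReal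
      (Real.rpow_le_rpow (M.len_pos i).le (M.len_le_h i) (by positivity))) _)).trans ?_
    rw [← Finset.mul_sum, ← lintegral_biUnion_finset hdisj fun _ _ => measurableSet_Ioo]
    refine mul_le_mul_right (lintegral_mono' (Measure.restrict_mono ?_ le_rfl) le_rfl) _
    exact iUnion₂_subset fun i _ => Ioo_subset_Ioo (M.node_mem _).1 (M.node_mem _).2
  have := ENNReal.toReal_mono (ENNReal.mul_ne_top ENNReal.ofReal_ne_top hΓ') key
  rw [ENNReal.toReal_ofReal (Finset.sum_nonneg fun i _ => h0 i), ENNReal.toReal_mul,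
    ENNReal.toReal_ofReal (by have := M.h_pos; positivity)] at this
  linarith

theorem hasRate_of_memSobolevAux {σ : ℝ} (hσ : 0 < σ) {k : ℝ → ℝ} (hk : MemSobolevAux σ 0 k) :
    HasRate σ k :=
  hasRate_of_gagliardoFinite hσ hk.1 (hk.2 hσ.ne')

theorem memSobolevAux_of_memSobolev {n : ℕ} {σ : ℝ} (h0 : 0 ≤ σ) (h1 : σ < 1) {k : ℝ → ℝ}
    (hk : MemSobolev (n + σ) k) : MemSobolevAux σ n k := by
  have e1 : Int.fract ((n : ℝ) + σ) = σ := by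
    rw [Int.fract_natCast_add, Int.fract_eq_self.2 ⟨h0, h1⟩]
  have e2 : ⌊(n : ℝ) + σ⌋₊ = n := by
    rw [Nat.floor_eq_iff (by positivity)]
    constructor <;> linarith
  rwa [MemSobolev, e1, e2] at hk

/-! ### The error estimate -/

/-- The projection is at least as good as any piecewise constant and keeps the nodal derivatives of
the state, so it combines the rate with discrete feasibility. -/
theorem HasRate.exists_normL2_sub_le {α : ℝ} {g : ℝ → ℝ} (hg : HasRate α g) :
    ∃ C : ℝ, 0 ≤ C ∧ ∀ M : Mesh, ∃ z, M.IsPwAffine z ∧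
      (∀ j, mzPrim z (M.node j) = mzPrim g (M.node j)) ∧ normL2 (z - g) ≤ C * M.h ^ α := by
  obtain ⟨hg2, C, hC, hM⟩ := hg
  refine ⟨Real.sqrt C, Real.sqrt_nonneg _, fun M => ?_⟩
  obtain ⟨c, hc⟩ := hM M
  obtain ⟨z, hz, hzn, hzmin⟩ := Mesh.exists_isPwAffine_projection M hg2
  refine ⟨z, hz, hzn, (hzmin (M.pwAffine c 0) ⟨c, 0, ae_eq_refl _⟩).trans ?_⟩
  have h0 := M.h_pos
  have e : Real.sqrt C * M.h ^ α = Real.sqrt (C * M.h ^ (2 * α)) := by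
    rw [Real.sqrt_mul hC, mul_comm 2 α, Real.rpow_mul h0.le, Real.rpow_two,
      Real.sqrt_sq (Real.rpow_nonneg h0.le _)]
  rw [e, normL2]
  apply Real.sqrt_le_sqrt
  refine le_of_eq_of_le ?_ hc
  rw [← M.sum_integral_cell ((M.memL2_pwAffine c 0).sub hg2).intervalIntegrable_sq]
  refine Finset.sum_congr rfl fun i _ => ?_
  rw [intervalIntegral.integral_of_le (M.node_lt i).le,
    intervalIntegral.integral_of_le (M.node_lt i).le]
  refine setIntegral_congr_fun measurableSet_Ioc fun x hx => ?_
  simp only [Pi.sub_apply]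
  rw [M.pwAffine_apply c 0 hx]
  simp; ring

/-- A function that is nonpositive at the end points of an interval is small inside if its
derivative is close to a constant. -/
theorem const_add_prim_le {k : ℝ → ℝ} (hk : MemL2 k) {d c a b x : ℝ} (ha : -1 ≤ a) (hb : b ≤ 1)
    (hab : a < b) (hx : x ∈ Icc a b) (hqa : d + prim k a ≤ 0) (hqb : d + prim k b ≤ 0) :
    d + prim k x ≤ ∫ t in a..b, |k t - c| := by
  have haI : a ∈ Icc (-1 : ℝ) 1 := ⟨ha, hab.le.trans hb⟩
  have hbI : b ∈ Icc (-1 : ℝ) 1 := ⟨ha.trans hab.le, hb⟩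
  have hxI : x ∈ Icc (-1 : ℝ) 1 := ⟨ha.trans hx.1, hx.2.trans hb⟩
  have hkc := hk.sub (memL2_const c)
  have key : ∀ {s t : ℝ}, s ∈ Icc (-1 : ℝ) 1 → t ∈ Icc (-1 : ℝ) 1 → s ≤ t →
      |prim k t - prim k s - c * (t - s)| ≤ ∫ r in s..t, |k r - c| := fun {s t} hs ht hst => by
    have e : prim k t - prim k s - c * (t - s) = ∫ r in s..t, (k r - c) := by
      rw [prim_sub_prim hk.intervalIntegrable hs ht,
        intervalIntegral.integral_sub (hk.intervalIntegrable' hs ht) (by simp),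
        intervalIntegral.integral_const, smul_eq_mul]; ring
    rw [e]
    exact intervalIntegral.abs_integral_le_integral_abs hst
  have h1 := (abs_le.1 (key haI hxI hx.1)).2
  have h2 := (abs_le.1 (key hxI hbI hx.2)).1
  have h3 : (∫ r in a..x, |k r - c|) + ∫ r in x..b, |k r - c| = ∫ r in a..b, |k r - c| :=
    intervalIntegral.integral_add_adjacent_intervals
      (hkc.intervalIntegrable' haI hxI).abs (hkc.intervalIntegrable' hxI hbI).abs
  have h4 : 0 ≤ ∫ r in a..x, |k r - c| :=
    intervalIntegral.integral_nonneg hx.1 fun _ _ => abs_nonneg _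
  have h5 : 0 ≤ ∫ r in x..b, |k r - c| :=
    intervalIntegral.integral_nonneg hx.2 fun _ _ => abs_nonneg _
  have h6 : 0 ≤ x - a := sub_nonneg.2 hx.1
  have h7 : 0 ≤ b - x := sub_nonneg.2 hx.2
  rw [← h3]
  set A := ∫ r in a..x, |k r - c|
  set B := ∫ r in x..b, |k r - c|
  have h8 : d + prim k x ≤ A + c * (x - a) := by linarith
  have h9 : d + prim k x ≤ B - c * (b - x) := by linarith
  -- Weighting the bounds from the two end points by the distances to the opposite ends cancels `c`.
  have h10 : (b - a) * (d + prim k x) ≤ (b - a) * (A + B) := by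
    have e1 := mul_le_mul_of_nonneg_left h8 h7
    have e2 := mul_le_mul_of_nonneg_left h9 h6
    nlinarith [mul_nonneg h6 h4, mul_nonneg h7 h5]
  exact le_of_mul_le_mul_left h10 (by linarith)

/-- The quadratic inequality behind the error estimate. -/
theorem le_of_sq_le {β A B e H : ℝ} (hβ : 0 < β) (hA : 0 ≤ A) (hB : 0 ≤ B) (hH : 0 < H)
    (h : β * e ^ 2 ≤ A * H * e + B * H ^ 2) : e ≤ ((A + B) / β + 1) * H := by
  by_contra! hlt
  have hD : β * ((A + B) / β) = A + B := mul_div_cancel₀ _ hβ.ne'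
  have h0 : 0 ≤ (A + B) / β := by positivity
  have h1 : H ≤ e := by nlinarith
  have h2 : (A + B + β) * H < β * e := by
    have := mul_lt_mul_of_pos_left hlt hβ
    nlinarith
  have he : 0 < e := hH.trans_le h1
  have h3 : (A + B + β) * H * e < β * e * e := mul_lt_mul_of_pos_right h2 he
  have h4 : B * H * H ≤ B * H * e := mul_le_mul_of_nonneg_left h1 (by positivity)
  have h5 : 0 < β * H * e := by positivity
  nlinarith

/-- The density of the multiplier shows the regularity of the optimal state. -/
theorem DualNonneg.hasRate {Θ f g : ℝ → ℝ} {α β : ℝ} (hβ : 0 < β) (hα : α ≤ 1 / 2)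
    (hΘ : ContinuousOn Θ (Icc (-1) 1)) (hf : HasRate α f) (hg : MemL2 g)
    (h : DualNonneg Θ (β • (g + f))) : HasRate α g := by
  obtain ⟨ρ, hρ, hρw⟩ := h.exists_monotone (memL2_of_continuousOn hΘ)
    ((hg.add hf.1).const_smul β)
  -- Solving `β (g + f) + prim Θ = ρ` for `g`.
  have := (((hasRate_of_monotoneOn (hρ.monotoneOn _) hα).sub (hasRate_prim hΘ hα)).const_smul
    β⁻¹).sub hf
  refine this.congr ?_
  filter_upwards [hρw] with x hx
  simp only [Pi.sub_apply, Pi.smul_apply, Pi.add_apply, smul_eq_mul] at hx ⊢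
  rw [← hx]
  field_simp; ring

/-- With `e` the `L₂` norm of `z - gh` and `H = h ^ α`, projection error and multiplier term
together give `β e² ≤ A H e + B H²`. The multiplier term gains a factor `√h ≤ E H` from the
interpolation of the slack, multiplied by the total mass `θ = prim Θ 1`. -/
theorem IsRedMin.exists_error_le {β α : ℝ} {yd f ψ ψ' g : ℝ → ℝ} (hβ : 0 < β) (hα : α ≤ 1 / 2)
    (hyd : MemL2 yd) (hf : HasRate α f) (hψ' : HasRate α ψ')
    (hψ : ∀ x ∈ Icc (-1 : ℝ) 1, ψ x = ψ (-1) + prim ψ' x)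
    (hpos : 0 < ∫ x in (-1 : ℝ)..1, ψ x) (hg : IsRedMin β yd f (Constraint ψ) g) :
    ∃ C : ℝ, 0 ≤ C ∧ ∀ (M : Mesh) (gh : ℝ → ℝ), IsRedMin β yd f (M.DiscreteConstraint ψ) gh →
      normL2 (g - gh) ≤ C * M.h ^ α := by
  obtain ⟨Θ, hΘc, hN, hN0, hNred⟩ := hg.exists_multiplier hyd hf.1 hψ'.1 hψ hpos
  have hg2 := hg.1
  have hΘ := memL2_of_continuousOn hΘc
  have hm : MemL2 (β • (g + f)) := (hg2.add hf.1).const_smul β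
  have hgr : HasRate α g := hN.hasRate hβ hα hΘc hf hg2
  obtain ⟨C₁, hC₁, hproj⟩ := hgr.exists_normL2_sub_le
  obtain ⟨hδ, C₂, hC₂, hδr⟩ := hψ'.sub hgr
  set d := ψ (-1) - mzPrim g (-1)
  have hδeq : ∀ x ∈ Icc (-1 : ℝ) 1, d + prim (ψ' - g) x = ψ x - mzPrim g x := fun x hx => by
    rw [prim_sub hψ'.1.intervalIntegrable hg2.intervalIntegrable hx, hψ x hx,
      ← mzPrim_left_add_prim g x]
    simp only [d]; ring
  have hθ : 0 ≤ prim Θ 1 := by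
    have := hN 1 0 (memL2_const 0) (fun x _ => by simp [prim])
    rwa [dualForm_const, one_mul] at this
  set θ := prim Θ 1
  set E := (2 : ℝ) ^ (1 / 2 - α) with hE
  have hE0 : (0 : ℝ) < E := by positivity
  set A := (48 * 48 + β) * C₁ + θ * E with hA
  set B := θ * E * Real.sqrt C₂ with hB
  have hA0 : 0 ≤ A := by positivity
  have hB0 : 0 ≤ B := by positivity
  refine ⟨C₁ + ((A + B) / β + 1), by positivity, fun M gh hgh => ?_⟩
  have h0 := M.h_pos
  set H := M.h ^ α with hH
  have hH0 : 0 < H := Real.rpow_pos_of_pos h0 _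
  obtain ⟨z, hz, hzn, hzg⟩ := hproj M
  have hz2 := hz.memL2
  have hzc : M.DiscreteConstraint ψ z := ⟨hz, fun j => by
    rw [hzn]; exact hg.2.1 _ (M.node_mem j)⟩
  have hQ : IsClosedConvexL2 (M.DiscreteConstraint ψ) :=
    Mesh.isClosedConvexL2_discreteConstraint ⟨z, hz2, hzc⟩
  have hgh2 := hgh.1
  have hl : MemL2 (z - gh) := hz2.sub hgh2
  have hl' : MemL2 (gh - z) := hgh2.sub hz2
  have hneg : normL2 (gh - z) = normL2 (z - gh) := by
    rw [← hl'.norm_toLp, ← hl.norm_toLp, hgh2.toLp_sub hz2, hz2.toLp_sub hgh2, norm_sub_rev]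
  set e := normL2 (z - gh) with he
  have he0 : 0 ≤ e := normL2_nonneg _
  obtain ⟨c, hc⟩ := hδr M
  have hsqrt : Real.sqrt M.h ≤ E * H := by
    rw [Real.sqrt_eq_rpow]; exact rpow_h_le M hα
  -- The difference of the two sides without the `√h` term is nonpositive at the nodes, since `gh`
  -- satisfies the constraint there and `z` has the same nodal derivatives as `g`.
  have hη : ∀ x ∈ Icc (-1 : ℝ) 1, mzPrim (gh - z) (-1) + prim (gh - z) x
      ≤ d + prim (ψ' - g) x + Real.sqrt M.h * (e + Real.sqrt C₂ * H) := fun x hx => by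
    obtain ⟨i, hi⟩ := M.exists_mem_cell hx
    have haI := M.node_mem i.castSucc
    have hbI := M.node_mem i.succ
    have hq : ∀ y ∈ Icc (-1 : ℝ) 1, (mzPrim (gh - z) (-1) - d) + prim ((gh - z) - (ψ' - g)) y
        = mzPrim (gh - z) y - (ψ y - mzPrim g y) := fun y hy => by
      rw [prim_sub hl'.intervalIntegrable hδ.intervalIntegrable hy, ← hδeq y hy,
        ← mzPrim_left_add_prim (gh - z) y]; ring
    have hqn : ∀ j, (mzPrim (gh - z) (-1) - d) + prim ((gh - z) - (ψ' - g)) (M.node j) ≤ 0 :=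
      fun j => by
        rw [hq _ (M.node_mem j), mzPrim_sub hgh2 hz2 (M.node_mem j), hzn]
        linarith [hgh.2.1.2 j]
    -- Only the slack derivative is compared with a constant, hence the sign in `-c i`; `gh - z` is
    -- counted entirely as error and contributes `√h e`.
    have h1 := const_add_prim_le (hl'.sub hδ) (c := -c i) haI.1 hbI.2 (M.node_lt i) hi
      (hqn _) (hqn _)
    rw [hq x hx, ← mzPrim_left_add_prim (gh - z) x, ← hδeq x hx] at h1
    let r : ℝ → ℝ := fun t => (ψ' - g) t - c i
    have hδc : MemL2 r := hδ.sub (memL2_const _)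
    have i1 := (hl'.intervalIntegrable' haI hbI).abs
    have i2 := (hδc.intervalIntegrable' haI hbI).abs
    have h2 : ∫ t in M.node i.castSucc..M.node i.succ, |((gh - z) - (ψ' - g)) t - -c i| ≤
        (∫ t in M.node i.castSucc..M.node i.succ, |(gh - z) t|) +
          ∫ t in M.node i.castSucc..M.node i.succ, |r t| := by
      rw [← intervalIntegral.integral_add i1 i2]
      refine intervalIntegral.integral_mono_on (M.node_lt i).le
        (((hl'.sub hδ).sub (memL2_const (-c i))).intervalIntegrable' haI hbI).abs (i1.add i2)
        fun t _ => ?_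
      have e1 : ((gh - z) - (ψ' - g)) t - -c i = (gh - z) t - r t := by
        simp only [Pi.sub_apply, r]; ring
      rw [e1]
      exact abs_sub _ _
    have hlen : Real.sqrt (M.node i.succ - M.node i.castSucc) ≤ Real.sqrt M.h :=
      Real.sqrt_le_sqrt (M.len_le_h i)
    have h3 : ∫ t in M.node i.castSucc..M.node i.succ, |(gh - z) t| ≤ Real.sqrt M.h * e := by
      refine (hl'.integral_abs_le haI hbI (M.node_lt i).le).trans ?_
      rw [hneg]
      exact mul_le_mul_of_nonneg_right hlen he0
    have h4 : ∫ t in M.node i.castSucc..M.node i.succ, |r t|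
        ≤ Real.sqrt M.h * (Real.sqrt C₂ * H) := by
      have h5 := intervalIntegral_abs_sq_le (M.node_lt i).le (hδc.intervalIntegrable' haI hbI)
        (intervalIntegrable_of_Icc hδc.intervalIntegrable_sq haI hbI)
      have h6 : ∫ t in M.node i.castSucc..M.node i.succ, r t ^ 2
          ≤ C₂ * M.h ^ (2 * α) := by
        refine le_trans ?_ hc
        exact Finset.single_le_sum (f := fun i : Fin M.n =>
          ∫ t in M.node i.castSucc..M.node i.succ, ((ψ' - g) t - c i) ^ 2)
          (fun i _ => intervalIntegral.integral_nonneg (M.node_lt i).le fun _ _ => sq_nonneg _)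
          (Finset.mem_univ i)
      refine abs_le_of_sq_le_sq' ?_ (by positivity) |>.2
      rw [mul_pow, mul_pow, Real.sq_sqrt h0.le, Real.sq_sqrt hC₂, hH, ← Real.rpow_mul_natCast h0.le,
        Nat.cast_ofNat, mul_comm α 2]
      refine h5.trans ?_
      exact mul_le_mul (M.len_le_h i) h6 (intervalIntegral.integral_nonneg (M.node_lt i).le
        fun _ _ => sq_nonneg _) h0.le
    linarith
  -- Complementarity enters here: the form vanishes at the slack, so only the excess times the total
  -- mass survives.
  have hcomp := hN.dualForm_le hΘ hm hl' hδ hη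
  rw [hN0, zero_add] at hcomp
  have hred : redDeriv β yd f g (z - gh) ≤ E * H * (e + Real.sqrt C₂ * H) * θ := by
    have e1 : redDeriv β yd f g (z - gh) = -redDeriv β yd f g (gh - z) := by
      rw [← redDeriv_neg_right, neg_sub]
    rw [e1, hNred _ hl', neg_neg]
    refine hcomp.trans ?_
    gcongr
  have hbasic := energyForm_le_of_isRedMin hQ hyd hf.1 hg2 hgh hz2 hzc
  have h1 := energyForm_le hβ (hz2.sub hg2) hl
  have h2 : β * e ^ 2 ≤ energyForm β (z - gh) (z - gh) := by
    rw [energyForm_self]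
    linarith [sq_nonneg (normL2 (dirSol (z - gh)))]
  have h3 : normL2 (z - g) * e ≤ C₁ * H * e := mul_le_mul_of_nonneg_right hzg he0
  have h4 : (48 * 48 + β) * (normL2 (z - g) * e) ≤ (48 * 48 + β) * (C₁ * H * e) :=
    mul_le_mul_of_nonneg_left h3 (by positivity)
  have h5 : e ≤ ((A + B) / β + 1) * H := by
    refine le_of_sq_le hβ hA0 hB0 hH0 ?_
    calc β * e ^ 2 ≤ (48 * 48 + β) * (C₁ * H * e) + E * H * (e + Real.sqrt C₂ * H) * θ := by
          linarith
      _ = A * H * e + B * H ^ 2 := by rw [hA, hB]; ring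
  have h6 : g - gh = (g - z) + (z - gh) := by abel
  have h7 : normL2 (g - z) = normL2 (z - g) := by
    rw [← (hg2.sub hz2).norm_toLp, ← (hz2.sub hg2).norm_toLp, hg2.toLp_sub hz2, hz2.toLp_sub hg2,
      norm_sub_rev]
  rw [h6]
  refine (normL2_add_le (hg2.sub hz2) hl).trans ?_
  rw [h7]
  linarith

/-! ### Transfer of the `L₂` bound to the original norms -/

theorem normL2_sub_control {f u g gh yh : ℝ → ℝ} (hgh : MemL2 gh)
    (hu : u =ᵐ[volI] -g - f) (h : EqOn yh (dirSol gh) (Icc (-1) 1)) :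
    normL2 (u - (-(weakDeriv^[2] yh) - f)) = normL2 (g - gh) := by
  have e : normL2 (u - (-(weakDeriv^[2] yh) - f)) ^ 2 = normL2 (g - gh) ^ 2 := by
    rw [normL2_sq, normL2_sq]
    apply integral_congr_ae
    filter_upwards [hu, weakDeriv_two_dirSol hgh h] with x h1 h2
    simp only [Pi.sub_apply, Pi.neg_apply] at h1 ⊢
    rw [h1, h2]; ring
  exact (pow_left_inj₀ (normL2_nonneg _) (normL2_nonneg _) two_ne_zero).1 e

theorem energyNorm_dirSol_le {β : ℝ} (hβ : 0 < β) {k y : ℝ → ℝ} (hk : MemL2 k)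
    (h : EqOn y (dirSol k) (Icc (-1) 1)) : energyNorm β y ≤ (48 + β + 1) * normL2 k := by
  have h0 := normL2_nonneg k
  rw [energyNorm, seminormH_two_dirSol hk h, normL2_congr_Icc h,
    Real.sqrt_le_left (by positivity)]
  have h1 : normL2 (dirSol k) ^ 2 ≤ (48 * normL2 k) ^ 2 :=
    pow_le_pow_left₀ (normL2_nonneg _) (normL2_dirSol_le hk) 2
  nlinarith [mul_nonneg hβ.le (sq_nonneg (normL2 k)), mul_nonneg (mul_nonneg hβ.le hβ.le)
    (sq_nonneg (normL2 k)), sq_nonneg (normL2 k)]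

/-- A continuous function in `H¹(I)` is a primitive. -/
theorem exists_eq_add_prim {ψ : ℝ → ℝ} (hψ : MemSobolev 1 ψ) (hψc : ContinuousOn ψ (Icc (-1) 1)) :
    ∃ ψ', MemL2 ψ' ∧ IsWeakDeriv ψ ψ' ∧ ∀ x ∈ Icc (-1 : ℝ) 1, ψ x = ψ (-1) + prim ψ' x := by
  obtain ⟨-, ψ', hw, hψ'⟩ := memSobolev_one_iff.1 hψ
  obtain ⟨c, hc⟩ := hw.ae_eq_prim hψ'.integrable
  have he : EqOn ψ (fun x => c + prim ψ' x) (Icc (-1) 1) :=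
    eqOn_of_ae_eq hc hψc (continuousOn_const.add (continuousOn_prim hψ'.intervalIntegrable))
  refine ⟨ψ', hψ', hw, fun x hx => ?_⟩
  have h1 := he left_mem
  simp only [prim_left, add_zero] at h1
  rw [he hx, h1]

/-- With second derivative `ψ'` the state has derivative `ψ` minus the mean of `ψ`, which lies below
`ψ` because this mean is positive. This is the feasible point. -/
theorem constraint_weakDeriv {ψ ψ' : ℝ → ℝ} (hψ' : MemL2 ψ')
    (hψ : ∀ x ∈ Icc (-1 : ℝ) 1, ψ x = ψ (-1) + prim ψ' x)
    (hpos : 0 < ∫ x in (-1 : ℝ)..1, ψ x) : Constraint ψ ψ' := by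
  have e : ∫ x in (-1 : ℝ)..1, ψ x = ∫ x in (-1 : ℝ)..1, (ψ (-1) + prim ψ' x) := by
    apply intervalIntegral.integral_congr
    intro x hx
    rw [uIcc_of_le (by norm_num)] at hx
    exact hψ x hx
  rw [e, integral_const_add_prim hψ'] at hpos
  intro x hx
  rw [hψ x hx, mzPrim]
  linarith

end DirichletOCP

open DirichletOCP in
theorem theorem3p1 (β : ℝ) (hβ : 0 < β) (yd f ψ : ℝ → ℝ)
    (hyd : DirichletOCP.MemL2 yd)
    (hf : ∀ ε : ℝ, 0 < ε → ε ≤ 1 / 2 → DirichletOCP.MemSobolev (1 / 2 - ε) f)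
    (hψ : ∀ ε : ℝ, 0 < ε → ε ≤ 1 / 2 → DirichletOCP.MemSobolev (3 / 2 - ε) ψ)
    (hψc : ContinuousOn ψ (Set.Icc (-1) 1))
    (hψpos : 0 < ∫ x, ψ x ∂DirichletOCP.volI) :
    ∃ y u : ℝ → ℝ,
      -- `(y, u)` is the unique solution of the optimal control problem
      DirichletOCP.IsSolution β yd f ψ y u ∧
      (∀ z w : ℝ → ℝ, DirichletOCP.IsSolution β yd f ψ z w →
        Set.EqOn z y (Set.Icc (-1) 1) ∧ w =ᵐ[DirichletOCP.volI] u) ∧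
      -- each discrete problem has a unique solution
      (∀ M : DirichletOCP.Mesh, ∃ yh : ℝ → ℝ, M.IsDiscreteSolution β yd f ψ yh ∧
        ∀ zh : ℝ → ℝ, M.IsDiscreteSolution β yd f ψ zh → Set.EqOn zh yh (Set.Icc (-1) 1)) ∧
      -- the error estimates
      ∀ γ ε : ℝ, 0 < ε → ∃ C : ℝ, 0 < C ∧
        ∀ M : DirichletOCP.Mesh, M.QuasiUniform γ →
          ∀ yh : ℝ → ℝ, M.IsDiscreteSolution β yd f ψ yh →
            DirichletOCP.seminormH 1 (y - yh) +
                DirichletOCP.normL2 (u - (-(DirichletOCP.weakDeriv^[2] yh) - f))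
              ≤ C * M.h ^ (1 / 2 - ε) ∧
            DirichletOCP.energyNorm β (y - yh) ≤ C * M.h ^ (1 / 2 - ε) := by
  have hfS : ∀ σ : ℝ, 0 ≤ σ → σ < 1 / 2 → MemSobolevAux σ 0 f := fun σ h0 h1 => by
    have := hf (1 / 2 - σ) (by linarith) (by linarith)
    refine memSobolevAux_of_memSobolev h0 (by linarith) ?_
    rwa [sub_sub_cancel, ← zero_add σ, ← Nat.cast_zero] at this
  have hψS : ∀ σ : ℝ, 0 ≤ σ → σ < 1 / 2 → MemSobolevAux σ 1 ψ := fun σ h0 h1 => by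
    have := hψ (1 / 2 - σ) (by linarith) (by linarith)
    refine memSobolevAux_of_memSobolev h0 (by linarith) ?_
    rwa [show (3 : ℝ) / 2 - (1 / 2 - σ) = ((1 : ℕ) : ℝ) + σ by push_cast; ring] at this
  have hf2 : MemL2 f := (hfS 0 le_rfl (by norm_num)).1
  -- The choice `ε = 1/2` puts `ψ` in `H¹(I)`.
  obtain ⟨ψ', hψ'2, hψw, hψe⟩ := exists_eq_add_prim (by
    have := hψ (1 / 2) (by norm_num) le_rfl
    rwa [show (3 : ℝ) / 2 - 1 / 2 = 1 by norm_num] at this) hψc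
  rw [integral_volI] at hψpos
  have hP : IsClosedConvexL2 (Constraint ψ) :=
    isClosedConvexL2_constraint ⟨ψ', hψ'2, constraint_weakDeriv hψ'2 hψe hψpos⟩
  obtain ⟨g, hg⟩ := hP.exists_isRedMin hβ hyd hf2
  -- The projected optimal second derivative is feasible on every mesh.
  have hPh : ∀ M : Mesh, IsClosedConvexL2 (M.DiscreteConstraint ψ) := fun M => by
    obtain ⟨z, hz, hzn, -⟩ := Mesh.exists_isPwAffine_projection M hg.1
    exact Mesh.isClosedConvexL2_discreteConstraint ⟨z, hz.memL2, hz, fun j => by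
      rw [hzn]; exact hg.2.1 _ (M.node_mem j)⟩
  refine ⟨dirSol g, -g - f, (isSolution_iff hf2 hψc).2 ⟨g, hg, eqOn_refl _ _, ae_eq_refl _⟩,
    fun z w hzw => ?_, fun M => ?_, fun γ ε hε => ?_⟩
  · obtain ⟨k, hk, hzk, hwk⟩ := (isSolution_iff hf2 hψc).1 hzw
    have hkg := hg.ae_eq hP hβ hyd hf2 hk
    refine ⟨fun x hx => (hzk hx).trans (dirSol_congr hkg hx), hwk.trans ?_⟩
    filter_upwards [hkg] with x hx
    simp [hx]
  · obtain ⟨gh, hgh⟩ := (hPh M).exists_isRedMin hβ hyd hf2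
    refine ⟨dirSol gh, Mesh.isDiscreteSolution_iff.2 ⟨gh, hgh, eqOn_refl _ _⟩, fun zh hzh => ?_⟩
    obtain ⟨k, hk, hzk⟩ := Mesh.isDiscreteSolution_iff.1 hzh
    exact fun x hx => (hzk hx).trans (dirSol_congr (hgh.ae_eq (hPh M) hβ hyd hf2 hk) hx)
  -- The Gagliardo argument needs a positive order below `1/2`. For large `ε` the order is cut off
  -- at `1/4`, and boundedness of `h` converts the stronger rate into the required one.
  · set σ := 1 / 2 - min ε (1 / 4) with hσ
    have hm0 : 0 < min ε (1 / 4) := lt_min hε (by norm_num)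
    have hσ0 : 0 < σ := by linarith [min_le_right ε (1 / 4 : ℝ)]
    have hσ1 : σ < 1 / 2 := by linarith
    have hσε : 1 / 2 - ε ≤ σ := by linarith [min_le_left ε (1 / 4 : ℝ)]
    have hfr : HasRate σ f := hasRate_of_memSobolevAux hσ0 (hfS σ hσ0.le hσ1)
    have hψr : HasRate σ ψ' := by
      obtain ⟨-, k, hk, hkσ⟩ := hψS σ hσ0.le hσ1
      exact (hasRate_of_memSobolevAux hσ0 hkσ).congr (hk.ae_eq hψw)
    obtain ⟨C, hC, herr⟩ := hg.exists_error_le hβ hσ1.le hyd hfr hψr hψe hψpos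
    set K := C * 2 ^ (σ - (1 / 2 - ε)) with hK
    have hK0 : 0 ≤ K := by positivity
    -- `62 + β` is the sum of `12 + 1` for the first estimate and `48 + β + 1` for the energy norm;
    -- the final `1` keeps the constant positive if `K = 0`.
    refine ⟨(62 + β) * K + 1, by positivity, fun M _ yh hyh => ?_⟩
    obtain ⟨gh, hgh, hyg⟩ := Mesh.isDiscreteSolution_iff.1 hyh
    have hd2 : MemL2 (g - gh) := hg.1.sub hgh.1
    have hdy : EqOn (dirSol g - yh) (dirSol (g - gh)) (Icc (-1) 1) := fun x hx => by
      rw [Pi.sub_apply, hyg hx, dirSol_sub hg.1 hgh.1 hx]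
    have hH : 0 < M.h ^ (1 / 2 - ε) := Real.rpow_pos_of_pos M.h_pos _
    have hle : normL2 (g - gh) ≤ K * M.h ^ (1 / 2 - ε) := by
      refine (herr M gh hgh).trans ?_
      rw [hK, mul_assoc]
      exact mul_le_mul_of_nonneg_left (rpow_h_le M hσε) hC
    have hn := normL2_nonneg (g - gh)
    have hKH : 0 ≤ K * M.h ^ (1 / 2 - ε) := by positivity
    constructor
    · rw [seminormH_one_dirSol hd2 hdy, normL2_sub_control hgh.1 (ae_eq_refl _) hyg]
      have := normL2_mzPrim_le hd2
      nlinarith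
    · refine (energyNorm_dirSol_le hβ hd2 hdy).trans ?_
      nlinarith [mul_le_mul_of_nonneg_left hle (by linarith : 0 ≤ 48 + β + 1)]
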